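/- Let $K$ be a field of characteristic $0$ and let $\theta$, $\mathfrak g$ be finite-dimensional $K$-vector spaces. Put $V=\theta\oplus\mathfrak g$ with $\theta$ in degree $1$ and $\mathfrak g$ in degree $0$, and let $\mathcal S=S^\bullet(V[2]\oplus V^*[1])$ be the graded symmetric algebra; its generators $\mathfrak g,\theta,\mathfrak g^*,\theta^*$ have degrees $-2,-1,-1,-2$. The big bracket $\{\cdot,\cdot\}:\mathcal S\otimes\mathcal S\to\mathcal S$ is the bilinear map of degree $3$ determined by $\{v,v'\}=\{\epsilon,\epsilon'\}=0$ and $\{v,\epsilon\}=(-1)^{|v|}\langle v,\epsilon\rangle$ for $v,v'\in V[2]$, $\epsilon,\epsilon'\in V^*[1]$, by $\{a,b\}=-(-1)^{(|a|+3)(|b|+3)}\{b,a\}$, and by $\{a,b\odot c\}=\{a,b\}\odot c+(-1)^{(|a|+3)|b|}\,b\odot\{a,c\}$. A *weak Lie 2-bialgebra* on $(\theta,\mathfrak g)$ is an element of degree $-4$ $$\varepsilon=\varepsilon^{12}_{00}+\varepsilon^{01}_{11}+\varepsilon^{03}_{10}+\varepsilon^{10}_{01}+\varepsilon^{00}_{21}+\varepsilon^{11}_{10}+\varepsilon^{01}_{30},\qquad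 \varepsilon^{pq}_{kl}\in(\odot^q\mathfrak g^*)\odot(\odot^l\theta^*)\odot(\odot^k\theta)\odot(\odot^p\mathfrak g),$$ with $\{\varepsilon,\varepsilon\}=0$. It is *strict* if $\varepsilon^{03}_{10}=0$ and $\varepsilon^{01}_{30}=0$. A *Lie algebra crossed module* $\theta\xrightarrow{\phi}\mathfrak g$ consists of Lie algebra structures on $\theta$ and $\mathfrak g$, a linear map $\phi$ and an action $\triangleright$ of $\mathfrak g$ on $\theta$ by derivations such that $\phi(u)\triangleright v=[u,v]$ and $\phi(x\triangleright u)=[x,\phi(u)]$ for all $x\in\mathfrak g$ and $u,v\in\theta$; its semidirect product is denoted $\mathfrak g\ltimes\theta$. A *Lie bialgebra crossed module* on $(\theta,\mathfrak g)$ is a pair of Lie algebra crossed modules $\theta\xrightarrow{\phi}\mathfrak g$ and $\mathfrak g^*\xrightarrow{-\phi^*}\theta^*$ such that $(\mathfrak g\ltimes\theta,\ \theta^*\ltimes\mathfrak g^*)$ is a Lie bialgebra, where $\theta^*\ltimes\mathfrak g^*$ is identified with the dual of $\mathfrak g\ltimes\theta$ by $\langle(\kappa,\xi),(x,u)\rangle=\xi(x)+\kappa(u)$.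 **Theorem.** There is a bijection between strict Lie 2-bialgebras on $(\theta,\mathfrak g)$ and Lie bialgebra crossed modules on $(\theta,\mathfrak g)$, under which $\varepsilon$ corresponds to the pair of crossed modules $\theta\xrightarrow{\phi}\mathfrak g$, $\mathfrak g^*\xrightarrow{-\phi^*}\theta^*$ with $$\phi(u)=\{\varepsilon^{10}_{01},u\},\quad [x,y]=\{\{\varepsilon^{12}_{00},x\},y\},\quad x\triangleright u=\{\{\varepsilon^{01}_{11},x\},u\},$$ $$[\kappa_1,\kappa_2]_*=\{\{\varepsilon^{00}_{21},\kappa_1\},\kappa_2\},\quad \kappa\triangleright\xi=\{\{\varepsilon^{11}_{10},\kappa\},\xi\}$$ for all $x,y\in\mathfrak g$, $u\in\theta$, $\xi\in\mathfrak g^*$ and $\kappa,\kappa_1,\kappa_2\in\theta^*$. -/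

import Mathlib

open scoped TensorProduct

noncomputable section

/-! ### Lie algebras, Lie algebra crossed modules, Lie bialgebras on given vector spaces -/

/-- A Lie algebra structure on the vector space `L`. -/
@[ext]
structure LieStr (K L : Type*) [Field K] [AddCommGroup L] [Module K L] where
  bracket : L →ₗ[K] L →ₗ[K] L
  self : ∀ x, bracket x x = 0
  jacobi : ∀ x y z,
    bracket (bracket x y) z + bracket (bracket y z) x + bracket (bracket z x) y = 0

theorem LieStr.skew {K L : Type*} [Field K] [AddCommGroup L] [Module K L] (A : LieStr K L)
    (x y : L) : A.bracket x y = -A.bracket y x := by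
  have h := A.self (x + y)
  simp only [map_add, LinearMap.add_apply, A.self, zero_add, add_zero] at h
  exact eq_neg_of_add_eq_zero_right h

/-- A Lie algebra crossed module `φ : θ → 𝔤` on given vector spaces: Lie brackets on `θ` and `𝔤`,
a linear map `φ`, and an action `act x u = x ▷ u` of `𝔤` on `θ` by derivations. -/
@[ext]
structure LieCrossedModule (K θ g : Type*) [Field K] [AddCommGroup θ] [Module K θ]
    [AddCommGroup g] [Module K g] where
  lieTop : LieStr K θ
  lieBase : LieStr K g
  φ : θ →ₗ[K] g
  act : g →ₗ[K] θ →ₗ[K] θ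
  act_bracket : ∀ x y u, act (lieBase.bracket x y) u = act x (act y u) - act y (act x u)
  act_derivation : ∀ x u v,
    act x (lieTop.bracket u v) = lieTop.bracket (act x u) v + lieTop.bracket u (act x v)
  peiffer : ∀ u v, act (φ u) v = lieTop.bracket u v
  equivariant : ∀ x u, φ (act x u) = lieBase.bracket x (φ u)

/-- The semidirect product Lie algebra `𝔤 ⋉ θ` of a Lie algebra crossed module, on `𝔤 × θ`:
`[(x, u), (y, v)] = ([x, y], x ▷ v - y ▷ u + [u, v])`. -/
def LieCrossedModule.semidirect {K θ g : Type*} [Field K] [AddCommGroup θ] [Module K θ]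
    [AddCommGroup g] [Module K g] (M : LieCrossedModule K θ g) : LieStr K (g × θ) where
  bracket := LinearMap.mk₂ K
    (fun a b => (M.lieBase.bracket a.1 b.1,
      M.act a.1 b.2 - M.act b.1 a.2 + M.lieTop.bracket a.2 b.2))
    (by intro a b c; ext <;> simp; abel)
    (by intro r a b; ext <;> simp [smul_sub])
    (by intro a b c; ext <;> simp; abel)
    (by intro r a b; ext <;> simp [smul_sub])
  self a := by simp [LinearMap.mk₂_apply, M.lieBase.self, M.lieTop.self]
  jacobi a b c := by
    simp only [LinearMap.mk₂_apply, Prod.mk_add_mk, M.lieBase.jacobi, Prod.mk_eq_zero, true_and]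
    have h := M.lieTop.jacobi a.2 b.2 c.2
    have s1 := M.lieTop.skew a.2 (M.act c.1 b.2)
    have s2 := M.lieTop.skew b.2 (M.act a.1 c.2)
    have s3 := M.lieTop.skew c.2 (M.act b.1 a.2)
    simp only [map_sub, map_add, LinearMap.sub_apply, LinearMap.add_apply, M.act_bracket,
      M.act_derivation, s1, s2, s3]
    rw [← h]
    abel

/-- The adjoint action of `x` on `L ⊗ L`. -/
def LieStr.adTensor {K L : Type*} [Field K] [AddCommGroup L] [Module K L] (A : LieStr K L)
    (x : L) : L ⊗[K] L →ₗ[K] L ⊗[K] L :=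
  (A.bracket x).rTensor L + (A.bracket x).lTensor L

/-- `(L, L')` is a Lie bialgebra, where the vector space of `L'` is identified with the dual of
that of `L` through `e`: the cobracket `∂ : L → L ⊗ L` dual to the bracket of `L'` is a
`1`-cocycle, `∂ [x, y] = x · ∂ y - y · ∂ x`. -/
def IsLieBialgebra {K L L' : Type*} [Field K] [AddCommGroup L] [Module K L]
    [AddCommGroup L'] [Module K L'] (A : LieStr K L) (A' : LieStr K L')
    (e : L' ≃ₗ[K] Module.Dual K L) : Prop :=
  ∃ cobr : L →ₗ[K] L ⊗[K] L,
    (∀ (x : L) (α β : L'),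
      TensorProduct.dualDistrib K L L (e α ⊗ₜ e β) (cobr x) = e (A'.bracket α β) x) ∧
    ∀ x y : L, cobr (A.bracket x y) = A.adTensor x (cobr y) - A.adTensor y (cobr x)

/-- The identification of `θ* × 𝔤*` with the dual of `𝔤 × θ`: `(κ, ξ)` sends `(x, u)` to
`ξ x + κ u`. -/
def dualPairing (K θ g : Type*) [Field K] [AddCommGroup θ] [Module K θ]
    [AddCommGroup g] [Module K g] :
    (Module.Dual K θ × Module.Dual K g) ≃ₗ[K] Module.Dual K (g × θ) :=
  (LinearEquiv.prodComm K (Module.Dual K θ) (Module.Dual K g)).trans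
    (Module.dualProdDualEquivDual K g θ)

/-- A Lie bialgebra crossed module on the vector spaces `θ` and `𝔤`: Lie algebra crossed modules
`φ : θ → 𝔤` and `-φ* : 𝔤* → θ*` such that `(𝔤 ⋉ θ, θ* ⋉ 𝔤*)` is a Lie bialgebra. -/
@[ext]
structure LieBialgebraCrossedModule (K θ g : Type*) [Field K] [AddCommGroup θ] [Module K θ]
    [AddCommGroup g] [Module K g] where
  cm : LieCrossedModule K θ g
  dualCm : LieCrossedModule K (Module.Dual K g) (Module.Dual K θ)
  dual_φ : dualCm.φ = -cm.φ.dualMap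
  isLieBialgebra : IsLieBialgebra cm.semidirect dualCm.semidirect (dualPairing K θ g)

/-! ### The algebra `S(V[2] ⊕ V*[1])` and the big bracket -/

/-- The directional derivative along the functional `α` on a symmetric algebra: the derivation
with `∂_α w = α w` on generators. -/
def symDeriv {K W : Type*} [Field K] [AddCommGroup W] [Module K W] (α : Module.Dual K W) :
    SymmetricAlgebra K W →ₗ[K] SymmetricAlgebra K W :=
  (TrivSqZeroExt.sndHom (SymmetricAlgebra K W) (SymmetricAlgebra K W)).restrictScalars K ∘ₗ
    (SymmetricAlgebra.lift
      ((TrivSqZeroExt.inlAlgHom K (SymmetricAlgebra K W) (SymmetricAlgebra K W)).toLinearMap ∘ₗ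
          SymmetricAlgebra.ι K W +
        (TrivSqZeroExt.inrHom (SymmetricAlgebra K W) (SymmetricAlgebra K W)).restrictScalars K ∘ₗ
          Algebra.linearMap K (SymmetricAlgebra K W) ∘ₗ α)).toLinearMap

theorem symDeriv_ι {K W : Type*} [Field K] [AddCommGroup W] [Module K W] (α : Module.Dual K W)
    (w : W) : symDeriv α (SymmetricAlgebra.ι K W w) = algebraMap K _ (α w) := by
  simp [symDeriv, Algebra.algebraMap_eq_smul_one]

theorem symDeriv_fst {K W : Type*} [Field K] [AddCommGroup W] [Module K W] (α : Module.Dual K W)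
    (a : SymmetricAlgebra K W) :
    (SymmetricAlgebra.lift
      ((TrivSqZeroExt.inlAlgHom K (SymmetricAlgebra K W) (SymmetricAlgebra K W)).toLinearMap ∘ₗ
          SymmetricAlgebra.ι K W +
        (TrivSqZeroExt.inrHom (SymmetricAlgebra K W) (SymmetricAlgebra K W)).restrictScalars K ∘ₗ
          Algebra.linearMap K (SymmetricAlgebra K W) ∘ₗ α) a).fst = a := by
  induction a using SymmetricAlgebra.induction with
  | algebraMap r => rw [AlgHom.commutes]; rfl
  | ι w => simp
  | mul a b ha hb => simp [ha, hb]
  | add a b ha hb => simp [ha, hb]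

theorem symDeriv_mul {K W : Type*} [Field K] [AddCommGroup W] [Module K W] (α : Module.Dual K W)
    (a b : SymmetricAlgebra K W) :
    symDeriv α (a * b) = a * symDeriv α b + b * symDeriv α a := by
  simp [symDeriv_fst, symDeriv, TrivSqZeroExt.snd_mul, mul_comm b]

/-- The graded symmetric algebra `S(V[2] ⊕ V*[1])` of `V = θ ⊕ 𝔤`, with `θ` in degree `1` and `𝔤` in
degree `0`. In `V[2] ⊕ V*[1]` the spaces `𝔤`, `θ`, `𝔤*`, `θ*` have the degrees `-2`, `-1`, `-1`,
`-2`, so the graded symmetric algebra is the symmetric algebra of the even part `𝔤 × θ*` tensored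
with the exterior algebra of the odd part `θ × 𝔤*`. -/
abbrev BigAlg (K θ g : Type*) [Field K] [AddCommGroup θ] [Module K θ]
    [AddCommGroup g] [Module K g] : Type _ :=
  SymmetricAlgebra K (g × Module.Dual K θ) ⊗[K] ExteriorAlgebra K (θ × Module.Dual K g)

namespace BigAlg

variable (K : Type*) {θ g : Type*} [Field K] [AddCommGroup θ] [Module K θ]
  [AddCommGroup g] [Module K g]

/-- The inclusion of the even generators `𝔤 × θ*`. -/
def even : (g × Module.Dual K θ) →ₗ[K] BigAlg K θ g :=
  (Algebra.TensorProduct.includeLeft :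
    SymmetricAlgebra K (g × Module.Dual K θ) →ₐ[K] BigAlg K θ g).toLinearMap ∘ₗ
      SymmetricAlgebra.ι K _

/-- The inclusion of the odd generators `θ × 𝔤*`. -/
def odd : (θ × Module.Dual K g) →ₗ[K] BigAlg K θ g :=
  (Algebra.TensorProduct.includeRight :
    ExteriorAlgebra K (θ × Module.Dual K g) →ₐ[K] BigAlg K θ g).toLinearMap ∘ₗ
      ExteriorAlgebra.ι K

variable (θ g)

/-- The inclusion of `𝔤` (degree `-2`). -/
def ofBase : g →ₗ[K] BigAlg K θ g := even K ∘ₗ LinearMap.inl K g (Module.Dual K θ)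

/-- The inclusion of `θ*` (degree `-2`). -/
def ofTopDual : Module.Dual K θ →ₗ[K] BigAlg K θ g :=
  even K ∘ₗ LinearMap.inr K g (Module.Dual K θ)

/-- The inclusion of `θ` (degree `-1`). -/
def ofTop : θ →ₗ[K] BigAlg K θ g := odd K ∘ₗ LinearMap.inl K θ (Module.Dual K g)

/-- The inclusion of `𝔤*` (degree `-1`). -/
def ofBaseDual : Module.Dual K g →ₗ[K] BigAlg K θ g :=
  odd K ∘ₗ LinearMap.inr K θ (Module.Dual K g)

/-- The subspace `(⊙^q 𝔤*) ⊙ (⊙^l θ*) ⊙ (⊙^k θ) ⊙ (⊙^p 𝔤)`, which holds the component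
`ε^{pq}_{kl}` and is of degree `-(2p + q + k + 2l)`. -/
def component (p q k l : ℕ) : Submodule K (BigAlg K θ g) :=
  LinearMap.range (ofBaseDual K θ g) ^ q * LinearMap.range (ofTopDual K θ g) ^ l *
    LinearMap.range (ofTop K θ g) ^ k * LinearMap.range (ofBase K θ g) ^ p

/-- The duality pairing of the even generators with the odd ones:
`⟨(x, κ), (u, ξ)⟩ = ξ x + κ u`. -/
def pairing : (g × Module.Dual K θ) →ₗ[K] Module.Dual K (θ × Module.Dual K g) :=
  LinearMap.mk₂ K (fun w η => η.2 w.1 + w.2 η.1)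
    (by intro a b c; simp; abel) (by intro r a b; simp [mul_add])
    (by intro a b c; simp; abel) (by intro r a b; simp [mul_add])

/-- The left derivative by an odd generator in the direction of the functional `η ↦ ⟨w, η⟩`. -/
def oddDeriv (w : g × Module.Dual K θ) : BigAlg K θ g →ₗ[K] BigAlg K θ g :=
  TensorProduct.map LinearMap.id (CliffordAlgebra.contractLeft (pairing K θ g w))

/-- The derivative by an even generator in the direction of the functional `α`. -/
def evenDeriv (α : Module.Dual K (g × Module.Dual K θ)) : BigAlg K θ g →ₗ[K] BigAlg K θ g :=
  TensorProduct.map (symDeriv α) LinearMap.id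

/-- The parity operator `F ↦ (-1)^{|F|} F`. -/
def parity : BigAlg K θ g →ₗ[K] BigAlg K θ g :=
  TensorProduct.map LinearMap.id
    (CliffordAlgebra.involute
      (Q := (0 : QuadraticForm K (θ × Module.Dual K g)))).toLinearMap

/-- The big bracket, the odd Poisson bracket of degree `3` on `S(V[2] ⊕ V*[1])` determined by
* `{w, w'} = {η, η'} = 0` and `{w, η} = -{η, w} = ⟨w, η⟩` for even generators `w, w'` and odd
  generators `η, η'`, that is, `{v, ε} = (-1)^{|v|} ⟨v, ε⟩` for `v` in `V[2]`, `ε` in `V*[1]`;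
* `{F, G} = -(-1)^{(|F| + 3)(|G| + 3)} {G, F}`;
* `{F, G ⊙ H} = {F, G} ⊙ H + (-1)^{(|F| + 3)|G|} G ⊙ {F, H}`.
With a basis `w_i` of the even generators and the dual basis `η_i` of the odd ones, these rules give
`{F, G} = ∑_i (∂/∂η_i)((-1)^{|F|} F) ⊙ (∂/∂w_i) G + (∂/∂w_i) F ⊙ (∂/∂η_i) G`, with left
derivatives by the `η_i`. -/
def bigBracket [FiniteDimensional K θ] [FiniteDimensional K g] :
    BigAlg K θ g →ₗ[K] BigAlg K θ g →ₗ[K] BigAlg K θ g :=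
  let b := Module.finBasis K (g × Module.Dual K θ)
  ∑ i, ((LinearMap.mul K (BigAlg K θ g)).compl₁₂
          (oddDeriv K θ g (b i) ∘ₗ parity K θ g) (evenDeriv K θ g (b.coord i)) +
        (LinearMap.mul K (BigAlg K θ g)).compl₁₂
          (evenDeriv K θ g (b.coord i)) (oddDeriv K θ g (b i)))

end BigAlg

/-! ### Weak and strict Lie 2-bialgebras -/

/-- A weak Lie 2-bialgebra on the vector spaces `θ` and `𝔤`: an element `ε` of degree `-4` of
`S(V[2] ⊕ V*[1])`, the sum of seven components in the indicated subspaces, with `{ε, ε} = 0`.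
The field `ε12_00` is the component `ε^{12}_{00}`, and so on. -/
@[ext]
structure WeakLie2Bialgebra (K θ g : Type*) [Field K] [AddCommGroup θ] [Module K θ]
    [AddCommGroup g] [Module K g] [FiniteDimensional K θ] [FiniteDimensional K g] where
  ε12_00 : BigAlg K θ g
  ε01_11 : BigAlg K θ g
  ε03_10 : BigAlg K θ g
  ε10_01 : BigAlg K θ g
  ε00_21 : BigAlg K θ g
  ε11_10 : BigAlg K θ g
  ε01_30 : BigAlg K θ g
  mem12_00 : ε12_00 ∈ BigAlg.component K θ g 1 2 0 0
  mem01_11 : ε01_11 ∈ BigAlg.component K θ g 0 1 1 1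
  mem03_10 : ε03_10 ∈ BigAlg.component K θ g 0 3 1 0
  mem10_01 : ε10_01 ∈ BigAlg.component K θ g 1 0 0 1
  mem00_21 : ε00_21 ∈ BigAlg.component K θ g 0 0 2 1
  mem11_10 : ε11_10 ∈ BigAlg.component K θ g 1 1 1 0
  mem01_30 : ε01_30 ∈ BigAlg.component K θ g 0 1 3 0
  bracket_self : BigAlg.bigBracket K θ g
    (ε12_00 + ε01_11 + ε03_10 + ε10_01 + ε00_21 + ε11_10 + ε01_30)
    (ε12_00 + ε01_11 + ε03_10 + ε10_01 + ε00_21 + ε11_10 + ε01_30) = 0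

/-- A weak Lie 2-bialgebra is strict if both homotopy components vanish. -/
def WeakLie2Bialgebra.IsStrict {K θ g : Type*} [Field K] [AddCommGroup θ] [Module K θ]
    [AddCommGroup g] [Module K g] [FiniteDimensional K θ] [FiniteDimensional K g]
    (E : WeakLie2Bialgebra K θ g) : Prop :=
  E.ε03_10 = 0 ∧ E.ε01_30 = 0

/-- A strict Lie 2-bialgebra on the vector spaces `θ` and `𝔤`. -/
abbrev StrictLie2Bialgebra (K θ g : Type*) [Field K] [AddCommGroup θ] [Module K θ]
    [AddCommGroup g] [Module K g] [FiniteDimensional K θ] [FiniteDimensional K g] : Type _ :=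
  {E : WeakLie2Bialgebra K θ g // E.IsStrict}

end

/-!
Let `W = 𝔤 × θ*` and `W' = θ × 𝔤*` be the spaces of even and of odd generators. The duality pairing
identifies `W'` with `W*`, and the big bracket is the odd Poisson bracket of this pairing. A strict
element is `ε = μ + r`, where `μ ∈ W ⊗ Λ²W'` collects the components of `[x, y]`, `x ▷ u`, `[κ, κ']`
and `κ ▷ ξ`, and `r ∈ S²W` is the component of `φ`. Bracketing with generators recovers these maps:
`B w w' = {{μ, w}, w'}` is an alternating bracket on `W`, and `R η = {r, η}` is the symmetric map
`(u, ξ) ↦ (φ u, ξ ∘ φ)` from `W'` to `W`. Conversely, in a basis of `𝔤` and `θ` every element of one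
of the five component subspaces is the element built from a unique structure map, where alternating
brackets are needed for the two components that are quadratic in `𝔤*` or in `θ`
(`BigAlg.exists_eq_baseElt` and its analogues, with uniqueness from
`bigBracket_bigBracket_baseElt` and its analogues).

The bracket `{ε, ε}` has a part in `W ⊗ Λ³W'`, which is the Jacobiator of `B`, and a part in `S²W ⊗
W'`, which is the action of `B` on the symmetric tensor `r`. They are separated by the bidegree, and
in characteristic zero each is detected by its iterated derivatives, because of Euler's identity.
Hence `{ε, ε} = 0` if and only if `B` is a Lie bracket that leaves `r` invariant
(`BigAlg.Encodes.bigBracket_self_eq_zero_iff`). Split along `W = 𝔤 × θ*`, the Jacobi identity says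
that `𝔤` and `θ*` are Lie algebras acting on `θ` and `𝔤*` and that they form a matched pair for the
dual actions, and invariance of `r` says that `φ` and `-φ*` are equivariant and that the Peiffer
brackets `φ(u) ▷ v` and `-φ*(ξ) ▷ η` are antisymmetric (`isCompatible_iff`).

These are exactly the data of a Lie bialgebra crossed module. The Lie brackets on `θ` and `𝔤*` have
to be the Peiffer brackets, and antisymmetry and equivariance make these Lie brackets on which `𝔤`
and `θ*` act by derivations (`LieCrossedModule.ofPeiffer`). Given both crossed modules, the cocycle
condition for `(𝔤 ⋉ θ, θ* ⋉ 𝔤*)`, tested on functionals, is equivalent to the two matched pair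
conditions, because its other components follow from equivariance and the Peiffer identities
(`isLieBialgebra_semidirect_iff`). So `LieBialgebraCrossedModule.toStrict`, which sends a Lie
bialgebra crossed module to the element of its structure maps, is well defined and bijective.
-/

noncomputable section

/-! ### Alternating bilinear maps -/

theorem skew_of_self {K V X : Type*} [Field K] [AddCommGroup V] [Module K V]
    [AddCommGroup X] [Module K X] {β : V →ₗ[K] V →ₗ[K] X} (h : ∀ x, β x x = 0)
    (x y : V) : β x y = -β y x := by
  have h1 := h (x + y)
  simp only [map_add, LinearMap.add_apply, h, zero_add, add_zero] at h1
  exact eq_neg_of_add_eq_zero_right h1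

namespace BigAlg

/-! ### Calculus in the algebra `S(V[2] ⊕ V*[1])` -/

section Calculus

variable {K θ g : Type*} [Field K] [AddCommGroup θ] [Module K θ] [AddCommGroup g] [Module K g]

/-! The additive inverse on a tensor product of modules agrees with that of the ring structure only
after unfolding, so the usual rules for signs in products are restated. For the same reason some
identities are first proved as `key` in an arbitrary module or algebra and then specialized. -/

theorem mul_neg_eq (F G : BigAlg K θ g) : F * -G = -(F * G) := mul_neg F G

theorem neg_mul_eq (F G : BigAlg K θ g) : -F * G = -(F * G) := neg_mul F G

/-- To prove a linear statement about all elements of the algebra, it suffices to check that it is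
stable under left multiplication by generators. -/
theorem induction_left {P : BigAlg K θ g → Prop} (one : P 1)
    (add : ∀ F G, P F → P G → P (F + G)) (smul : ∀ (r : K) F, P F → P (r • F))
    (even_mul : ∀ w F, P F → P (even K w * F)) (odd_mul : ∀ η F, P F → P (odd K η * F))
    (F : BigAlg K θ g) : P F := by
  have sym : ∀ (a : SymmetricAlgebra K (g × Module.Dual K θ)) (F : BigAlg K θ g), P F →
      P ((a ⊗ₜ 1) * F) := by
    intro a
    induction a using SymmetricAlgebra.induction with
    | algebraMap r =>
      intro F hF
      have h : ((algebraMap K (SymmetricAlgebra K (g × Module.Dual K θ)) r) ⊗ₜ[K]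
          (1 : ExteriorAlgebra K (θ × Module.Dual K g))) * F = r • F := by
        rw [Algebra.algebraMap_eq_smul_one, ← TensorProduct.smul_tmul', smul_mul_assoc]
        exact congrArg (r • ·) (one_mul F)
      rw [h]
      exact smul r F hF
    | ι w => exact fun F hF => even_mul w F hF
    | mul a b ha hb =>
      intro F hF
      have h : ((a * b) ⊗ₜ[K] (1 : ExteriorAlgebra K (θ × Module.Dual K g))) =
          (a ⊗ₜ[K] 1) * (b ⊗ₜ[K] 1) := by simp
      rw [h, mul_assoc]
      exact ha _ (hb _ hF)
    | add a b ha hb =>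
      intro F hF
      rw [TensorProduct.add_tmul, add_mul]
      exact add _ _ (ha _ hF) (hb _ hF)
  have ext : ∀ c : ExteriorAlgebra K (θ × Module.Dual K g), P (1 ⊗ₜ c) := by
    intro c
    induction c using CliffordAlgebra.left_induction with
    | algebraMap r =>
      have h : ((1 : SymmetricAlgebra K (g × Module.Dual K θ)) ⊗ₜ[K]
          (algebraMap K (ExteriorAlgebra K (θ × Module.Dual K g)) r)) = r • 1 := by
        rw [Algebra.algebraMap_eq_smul_one, TensorProduct.tmul_smul]; rfl
      erw [h]
      exact smul r 1 one
    | add x y hx hy =>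
      rw [TensorProduct.tmul_add]
      exact add _ _ hx hy
    | ι_mul x m hx =>
      have h : ((1 : SymmetricAlgebra K (g × Module.Dual K θ)) ⊗ₜ[K]
          (ExteriorAlgebra.ι K m * x)) = odd K m * (1 ⊗ₜ x) := by
        simp [odd]
      erw [h]
      exact odd_mul m _ hx
  induction F using TensorProduct.induction_on with
  | zero => simpa using smul 0 1 one
  | tmul a c =>
    have h : a ⊗ₜ[K] c = (a ⊗ₜ 1) * ((1 : SymmetricAlgebra K (g × Module.Dual K θ)) ⊗ₜ[K] c) := by
      simp
    rw [h]
    exact sym a _ (ext c)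
  | add x y hx hy => exact add _ _ hx hy

theorem odd_mul_odd (η η' : θ × Module.Dual K g) :
    odd K η * odd K η' = -(odd K η' * odd K η) := by
  have h := ExteriorAlgebra.ι_add_mul_swap (R := K) η η'
  have h2 : (1 : SymmetricAlgebra K (g × Module.Dual K θ)) ⊗ₜ[K]
      (ExteriorAlgebra.ι K η * ExteriorAlgebra.ι K η' +
        ExteriorAlgebra.ι K η' * ExteriorAlgebra.ι K η) = 0 := by
    rw [h, TensorProduct.tmul_zero]
  rw [TensorProduct.tmul_add] at h2
  rw [eq_neg_iff_add_eq_zero, ← h2]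
  simp [odd]

theorem even_mul_comm (w : g × Module.Dual K θ) (F : BigAlg K θ g) :
    even K w * F = F * even K w := by
  induction F using TensorProduct.induction_on with
  | zero => simp
  | tmul a c => simp [even, mul_comm]
  | add x y hx hy => rw [mul_add, add_mul, hx, hy]

theorem smul_one_injective : Function.Injective (fun r : K => r • (1 : BigAlg K θ g)) := by
  intro r s h
  let F : BigAlg K θ g →ₐ[K] K := Algebra.TensorProduct.lift SymmetricAlgebra.algebraMapInv
    ExteriorAlgebra.algebraMapInv (fun _ _ => Commute.all _ _)
  have h1 : F (r • (1 : BigAlg K θ g)) = F (s • (1 : BigAlg K θ g)) := congrArg F h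
  rw [map_smul, map_smul, map_one] at h1
  simpa using h1

/-! ### Left derivatives by the odd generators -/

@[simp] theorem oddDeriv_one (w : g × Module.Dual K θ) : oddDeriv K θ g w 1 = 0 := by
  simp [oddDeriv, Algebra.TensorProduct.one_def]

@[simp] theorem oddDeriv_even_mul (w v : g × Module.Dual K θ) (F : BigAlg K θ g) :
    oddDeriv K θ g w (even K v * F) = even K v * oddDeriv K θ g w F := by
  induction F using TensorProduct.induction_on with
  | zero => simp
  | tmul a c => simp [even, oddDeriv]
  | add x y hx hy => rw [mul_add, map_add, hx, hy, map_add, mul_add]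

@[simp] theorem oddDeriv_odd_mul (w : g × Module.Dual K θ) (η : θ × Module.Dual K g)
    (F : BigAlg K θ g) : oddDeriv K θ g w (odd K η * F) =
      pairing K θ g w η • F - odd K η * oddDeriv K θ g w F := by
  induction F using TensorProduct.induction_on with
  | zero => simp
  | tmul a c =>
    have := CliffordAlgebra.contractLeft_ι_mul (Q := (0 : QuadraticForm K (θ × Module.Dual K g)))
      (d := pairing K θ g w) η c
    simp only [odd, oddDeriv, LinearMap.comp_apply, AlgHom.toLinearMap_apply,
      Algebra.TensorProduct.includeRight_apply, Algebra.TensorProduct.tmul_mul_tmul, one_mul,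
      TensorProduct.map_tmul, LinearMap.id_apply]
    erw [this]
    rw [TensorProduct.tmul_sub, TensorProduct.tmul_smul]
  | add x y hx hy => rw [mul_add, map_add, hx, hy, map_add, mul_add, smul_add]; abel

@[simp] theorem oddDeriv_even (w v : g × Module.Dual K θ) : oddDeriv K θ g w (even K v) = 0 := by
  simpa using oddDeriv_even_mul w v 1

@[simp] theorem oddDeriv_odd (w : g × Module.Dual K θ) (η : θ × Module.Dual K g) :
    oddDeriv K θ g w (odd K η) = pairing K θ g w η • 1 := by
  simpa using oddDeriv_odd_mul w η 1

theorem oddDeriv_comm (w w' : g × Module.Dual K θ) (F : BigAlg K θ g) :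
    oddDeriv K θ g w (oddDeriv K θ g w' F) = -oddDeriv K θ g w' (oddDeriv K θ g w F) := by
  induction F using induction_left with
  | one => simp
  | add F G hF hG => simp only [map_add, hF, hG]; abel
  | smul r F hF => simp only [map_smul, hF, smul_neg]
  | even_mul v F hF => simp only [oddDeriv_even_mul, hF, mul_neg_eq]
  | odd_mul η F hF => simp only [oddDeriv_odd_mul, hF, mul_neg_eq, map_sub, map_smul]; abel

/-! ### Derivatives by the even generators -/

@[simp] theorem evenDeriv_one (α : Module.Dual K (g × Module.Dual K θ)) :
    evenDeriv K θ g α 1 = 0 := by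
  have h : symDeriv α (1 : SymmetricAlgebra K (g × Module.Dual K θ)) = 0 := by
    have := symDeriv_mul α (1 : SymmetricAlgebra K (g × Module.Dual K θ)) 1
    simpa using this
  simp [evenDeriv, Algebra.TensorProduct.one_def, h]

@[simp] theorem evenDeriv_even_mul (α : Module.Dual K (g × Module.Dual K θ))
    (v : g × Module.Dual K θ) (F : BigAlg K θ g) :
    evenDeriv K θ g α (even K v * F) = α v • F + even K v * evenDeriv K θ g α F := by
  induction F using TensorProduct.induction_on with
  | zero => simp
  | tmul a c =>
    simp only [even, evenDeriv, LinearMap.comp_apply, AlgHom.toLinearMap_apply,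
      Algebra.TensorProduct.includeLeft_apply, Algebra.TensorProduct.tmul_mul_tmul, one_mul,
      TensorProduct.map_tmul, LinearMap.id_apply, symDeriv_mul, symDeriv_ι,
      TensorProduct.add_tmul]
    rw [mul_comm a, ← Algebra.smul_def, add_comm]
    rfl
  | add x y hx hy => rw [mul_add, map_add, hx, hy, map_add, mul_add, smul_add]; abel

@[simp] theorem evenDeriv_odd_mul (α : Module.Dual K (g × Module.Dual K θ))
    (η : θ × Module.Dual K g) (F : BigAlg K θ g) :
    evenDeriv K θ g α (odd K η * F) = odd K η * evenDeriv K θ g α F := by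
  induction F using TensorProduct.induction_on with
  | zero => simp
  | tmul a c => simp [odd, evenDeriv]
  | add x y hx hy => rw [mul_add, map_add, hx, hy, map_add, mul_add]

@[simp] theorem evenDeriv_even (α : Module.Dual K (g × Module.Dual K θ))
    (v : g × Module.Dual K θ) : evenDeriv K θ g α (even K v) = α v • 1 := by
  simpa using evenDeriv_even_mul α v 1

@[simp] theorem evenDeriv_odd (α : Module.Dual K (g × Module.Dual K θ))
    (η : θ × Module.Dual K g) : evenDeriv K θ g α (odd K η) = 0 := by
  simpa using evenDeriv_odd_mul α η 1

theorem even_injective :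
    Function.Injective (even K : (g × Module.Dual K θ) →ₗ[K] BigAlg K θ g) := by
  rw [← LinearMap.ker_eq_bot, LinearMap.ker_eq_bot']
  intro v h
  rw [← Module.forall_dual_apply_eq_zero_iff K]
  intro α
  have h2 : α v • (1 : BigAlg K θ g) = 0 := by rw [← evenDeriv_even, h, map_zero]
  exact smul_one_injective (h2.trans (zero_smul K _).symm)

@[simp] theorem pairing_apply (w : g × Module.Dual K θ) (η : θ × Module.Dual K g) :
    pairing K θ g w η = η.2 w.1 + w.2 η.1 := rfl

theorem odd_eq_zero_of_pairing {η : θ × Module.Dual K g} (h : ∀ w, pairing K θ g w η = 0) :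
    η = 0 := by
  ext
  · rw [Prod.fst_zero, ← Module.forall_dual_apply_eq_zero_iff K]
    intro κ
    simpa using h (0, κ)
  · rename_i x
    simpa using h (x, 0)

theorem even_eq_zero_of_pairing {w : g × Module.Dual K θ} (h : ∀ η, pairing K θ g w η = 0) :
    w = 0 := by
  ext
  · rw [Prod.fst_zero, ← Module.forall_dual_apply_eq_zero_iff K]
    intro ξ
    simpa using h (0, ξ)
  · rename_i u
    simpa using h (u, 0)

theorem odd_injective :
    Function.Injective (odd K : (θ × Module.Dual K g) →ₗ[K] BigAlg K θ g) := by
  rw [← LinearMap.ker_eq_bot, LinearMap.ker_eq_bot']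
  intro η h
  have h3 : ∀ w, pairing K θ g w η = 0 := by
    intro w
    have h2 : pairing K θ g w η • (1 : BigAlg K θ g) = 0 := by
      rw [← oddDeriv_odd, h, map_zero]
    exact smul_one_injective (h2.trans (zero_smul K _).symm)
  exact odd_eq_zero_of_pairing h3

theorem evenDeriv_comm (α β : Module.Dual K (g × Module.Dual K θ)) (F : BigAlg K θ g) :
    evenDeriv K θ g α (evenDeriv K θ g β F) = evenDeriv K θ g β (evenDeriv K θ g α F) := by
  induction F using induction_left with
  | one => simp
  | add F G hF hG => simp only [map_add, hF, hG]
  | smul r F hF => simp only [map_smul, hF]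
  | even_mul v F hF => simp only [evenDeriv_even_mul, map_add, map_smul, hF]; abel
  | odd_mul η F hF => simp only [evenDeriv_odd_mul, hF]

theorem oddDeriv_evenDeriv (w : g × Module.Dual K θ) (α : Module.Dual K (g × Module.Dual K θ))
    (F : BigAlg K θ g) :
    oddDeriv K θ g w (evenDeriv K θ g α F) = evenDeriv K θ g α (oddDeriv K θ g w F) := by
  induction F using induction_left with
  | one => simp
  | add F G hF hG => simp only [map_add, hF, hG]
  | smul r F hF => simp only [map_smul, hF]
  | even_mul v F hF => simp only [evenDeriv_even_mul, oddDeriv_even_mul, map_add, map_smul, hF]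
  | odd_mul η F hF => simp only [evenDeriv_odd_mul, oddDeriv_odd_mul, map_sub, map_smul, hF]

theorem evenDeriv_mul (α : Module.Dual K (g × Module.Dual K θ)) (F G : BigAlg K θ g) :
    evenDeriv K θ g α (F * G) = evenDeriv K θ g α F * G + F * evenDeriv K θ g α G := by
  induction F using induction_left with
  | one => simp
  | add F F' hF hF' => simp only [map_add, hF, hF', add_mul]; abel
  | smul r F hF => simp only [map_smul, hF, smul_mul_assoc, smul_add]
  | even_mul v F hF =>
    simp only [mul_assoc, evenDeriv_even_mul, hF, mul_add, add_mul, smul_mul_assoc]; abel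
  | odd_mul η F hF => simp only [mul_assoc, evenDeriv_odd_mul, hF, mul_add]

/-! ### The parity operator -/

@[simp] theorem parity_one : parity K θ g 1 = 1 := by
  simp [parity, Algebra.TensorProduct.one_def]

@[simp] theorem parity_even_mul (v : g × Module.Dual K θ) (F : BigAlg K θ g) :
    parity K θ g (even K v * F) = even K v * parity K θ g F := by
  induction F using TensorProduct.induction_on with
  | zero => simp
  | tmul a c => simp [even, parity]
  | add x y hx hy => rw [mul_add, map_add, hx, hy, map_add, mul_add]

@[simp] theorem parity_odd_mul (η : θ × Module.Dual K g) (F : BigAlg K θ g) :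
    parity K θ g (odd K η * F) = -(odd K η * parity K θ g F) := by
  induction F using TensorProduct.induction_on with
  | zero => simp
  | tmul a c =>
    simp only [odd, parity, LinearMap.comp_apply, AlgHom.toLinearMap_apply,
      Algebra.TensorProduct.includeRight_apply, Algebra.TensorProduct.tmul_mul_tmul, one_mul,
      TensorProduct.map_tmul, LinearMap.id_apply]
    rw [map_mul]
    erw [CliffordAlgebra.involute_ι]
    rw [← TensorProduct.tmul_neg]
    exact congrArg (a ⊗ₜ[K] ·) (neg_mul _ _)
  | add x y hx hy => rw [mul_add, map_add, hx, hy, map_add, mul_add]; abel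

@[simp] theorem parity_even (v : g × Module.Dual K θ) : parity K θ g (even K v) = even K v := by
  simpa using parity_even_mul v 1

@[simp] theorem parity_odd (η : θ × Module.Dual K g) : parity K θ g (odd K η) = -odd K η := by
  simpa using parity_odd_mul η 1

theorem parity_oddDeriv (w : g × Module.Dual K θ) (F : BigAlg K θ g) :
    parity K θ g (oddDeriv K θ g w F) = -oddDeriv K θ g w (parity K θ g F) := by
  induction F using induction_left with
  | one => simp
  | add F G hF hG => simp only [map_add, hF, hG, neg_add]
  | smul r F hF => simp only [map_smul, hF, smul_neg]
  | even_mul v F hF => simp only [parity_even_mul, oddDeriv_even_mul, hF, mul_neg_eq]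
  | odd_mul η F hF =>
    simp only [parity_odd_mul, oddDeriv_odd_mul, map_sub, map_neg, map_smul, hF, mul_neg_eq]; abel

theorem parity_evenDeriv (α : Module.Dual K (g × Module.Dual K θ)) (F : BigAlg K θ g) :
    parity K θ g (evenDeriv K θ g α F) = evenDeriv K θ g α (parity K θ g F) := by
  induction F using induction_left with
  | one => simp
  | add F G hF hG => simp only [map_add, hF, hG]
  | smul r F hF => simp only [map_smul, hF]
  | even_mul v F hF => simp only [parity_even_mul, evenDeriv_even_mul, map_add, map_smul, hF]
  | odd_mul η F hF => simp only [parity_odd_mul, evenDeriv_odd_mul, map_neg, hF]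

theorem oddDeriv_mul (w : g × Module.Dual K θ) (F G : BigAlg K θ g) :
    oddDeriv K θ g w (F * G) = oddDeriv K θ g w F * G + parity K θ g F * oddDeriv K θ g w G := by
  induction F using induction_left with
  | one => simp
  | add F F' hF hF' => simp only [map_add, hF, hF', add_mul]; abel
  | smul r F hF => simp only [map_smul, hF, smul_mul_assoc, smul_add]
  | even_mul v F hF =>
    simp only [mul_assoc, oddDeriv_even_mul, parity_even_mul, hF, mul_add]
  | odd_mul η F hF =>
    simp only [mul_assoc, oddDeriv_odd_mul, parity_odd_mul, hF, mul_add, sub_mul, smul_mul_assoc,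
      neg_mul_eq]
    abel

theorem odd_mul_eq_parity_mul (η : θ × Module.Dual K g) (F : BigAlg K θ g) :
    odd K η * F = parity K θ g F * odd K η := by
  induction F using induction_left with
  | one => simp
  | add F G hF hG => simp only [map_add, mul_add, add_mul, hF, hG]
  | smul r F hF => simp only [map_smul, smul_mul_assoc, mul_smul_comm, hF]
  | even_mul v F hF =>
    rw [← mul_assoc, ← even_mul_comm, mul_assoc, hF, parity_even_mul, mul_assoc]
  | odd_mul η' F hF => rw [← mul_assoc, odd_mul_odd, neg_mul_eq, mul_assoc, hF, parity_odd_mul,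
      neg_mul_eq, mul_assoc]

/-- Elements of even parity are central. -/
theorem mul_comm_of_parity_eq {F : BigAlg K θ g} (h : parity K θ g F = F) (G : BigAlg K θ g) :
    G * F = F * G := by
  induction G using induction_left with
  | one => simp
  | add G H hG hH => simp only [mul_add, add_mul, hG, hH]
  | smul r G hG => simp only [smul_mul_assoc, mul_smul_comm, hG]
  | even_mul v G hG => rw [mul_assoc, hG, ← mul_assoc, ← mul_assoc, even_mul_comm]
  | odd_mul η G hG => rw [mul_assoc, hG, ← mul_assoc, odd_mul_eq_parity_mul, h, mul_assoc]

end Calculus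

end BigAlg
end

noncomputable section

namespace BigAlg

/-! ### Dual bases, Euler operators and the big bracket with generators -/

section Euler

variable {K θ g : Type*} [Field K] [AddCommGroup θ] [Module K θ] [AddCommGroup g] [Module K g]

/-- The derivative by the even generators in the direction `w ↦ ⟨w, η⟩` of an odd generator `η`. -/
def flipDeriv (η : θ × Module.Dual K g) : BigAlg K θ g →ₗ[K] BigAlg K θ g :=
  evenDeriv K θ g ((pairing K θ g).flip η)

theorem smul_sub_self (r : K) (F : BigAlg K θ g) : r • F - F = (r - 1) • F :=
  ((sub_smul r 1 F).trans (congrArg (r • F - ·) (one_smul K F))).symm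

theorem oddDeriv_sum_smul {ι : Type*} (s : Finset ι) (c : ι → K) (w : ι → g × Module.Dual K θ)
    (F : BigAlg K θ g) :
    oddDeriv K θ g (∑ i ∈ s, c i • w i) F = ∑ i ∈ s, c i • oddDeriv K θ g (w i) F := by
  induction F using induction_left with
  | one => simp
  | add F G hF hG => simp only [map_add, hF, hG, smul_add, Finset.sum_add_distrib]
  | smul r F hF =>
    simp only [map_smul, hF, Finset.smul_sum]
    exact Finset.sum_congr rfl fun i _ => smul_comm _ _ _
  | even_mul v F hF => simp only [oddDeriv_even_mul, hF, Finset.mul_sum, mul_smul_comm]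
  | odd_mul η F hF =>
    simp only [oddDeriv_odd_mul, hF, Finset.mul_sum, mul_smul_comm, map_sum, map_smul, smul_sub,
      Finset.sum_sub_distrib, LinearMap.sum_apply, LinearMap.smul_apply, Finset.sum_smul,
      smul_assoc]

theorem evenDeriv_sum_smul {ι : Type*} (s : Finset ι) (c : ι → K)
    (α : ι → Module.Dual K (g × Module.Dual K θ)) (F : BigAlg K θ g) :
    evenDeriv K θ g (∑ i ∈ s, c i • α i) F = ∑ i ∈ s, c i • evenDeriv K θ g (α i) F := by
  induction F using induction_left with
  | one => simp
  | add F G hF hG => simp only [map_add, hF, hG, smul_add, Finset.sum_add_distrib]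
  | smul r F hF =>
    simp only [map_smul, hF, Finset.smul_sum]
    exact Finset.sum_congr rfl fun i _ => smul_comm _ _ _
  | even_mul v F hF =>
    simp only [evenDeriv_even_mul, hF, Finset.mul_sum, mul_smul_comm, smul_add,
      Finset.sum_add_distrib, LinearMap.sum_apply, LinearMap.smul_apply, Finset.sum_smul,
      smul_assoc]
  | odd_mul η F hF => simp only [evenDeriv_odd_mul, hF, Finset.mul_sum, mul_smul_comm]

variable [FiniteDimensional K θ] [FiniteDimensional K g]

/-- The odd generator that represents a functional on the even ones. -/
def toOdd (α : Module.Dual K (g × Module.Dual K θ)) : θ × Module.Dual K g :=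
  ((Module.evalEquiv K θ).symm (α ∘ₗ LinearMap.inr K g (Module.Dual K θ)),
    α ∘ₗ LinearMap.inl K g (Module.Dual K θ))

omit [FiniteDimensional K g] in
@[simp] theorem pairing_toOdd (w : g × Module.Dual K θ)
    (α : Module.Dual K (g × Module.Dual K θ)) : pairing K θ g w (toOdd α) = α w := by
  rw [pairing_apply]
  have h : w.2 (toOdd α).1 = α (0, w.2) := by
    simp [toOdd]
  rw [h]
  simp [toOdd, ← map_add]

variable (K θ g) in
/-- The basis of the even generators with which the big bracket is defined. -/
abbrev evenBasis : Module.Basis (Fin (Module.finrank K (g × Module.Dual K θ))) K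
    (g × Module.Dual K θ) :=
  Module.finBasis K (g × Module.Dual K θ)

variable (K θ g) in
/-- The dual basis of the odd generators. -/
def oddBasis (i : Fin (Module.finrank K (g × Module.Dual K θ))) : θ × Module.Dual K g :=
  toOdd ((evenBasis K θ g).coord i)

@[simp] theorem pairing_oddBasis (w : g × Module.Dual K θ)
    (i : Fin (Module.finrank K (g × Module.Dual K θ))) :
    pairing K θ g w (oddBasis K θ g i) = (evenBasis K θ g).coord i w := pairing_toOdd _ _

theorem evenDeriv_coord (i : Fin (Module.finrank K (g × Module.Dual K θ))) :
    evenDeriv K θ g ((evenBasis K θ g).coord i) = flipDeriv (oddBasis K θ g i) := by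
  unfold flipDeriv
  congr 1
  ext w <;> simp [-pairing_apply]

theorem sum_pairing_smul_oddBasis (η : θ × Module.Dual K g) :
    ∑ i, pairing K θ g (evenBasis K θ g i) η • oddBasis K θ g i = η := by
  rw [← sub_eq_zero]
  apply odd_eq_zero_of_pairing
  intro w
  rw [map_sub, map_sum]
  simp only [map_smul, pairing_oddBasis, smul_eq_mul]
  nth_rewrite 2 [← (evenBasis K θ g).sum_repr w]
  rw [map_sum, LinearMap.sum_apply, sub_eq_zero]
  exact Finset.sum_congr rfl fun i _ => by
    rw [map_smul, LinearMap.smul_apply, smul_eq_mul, mul_comm]; rfl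

theorem sum_coord_smul_evenBasis (w : g × Module.Dual K θ) :
    ∑ i, (evenBasis K θ g).coord i w • evenBasis K θ g i = w :=
  (evenBasis K θ g).sum_repr w

theorem sum_pairing_smul_coord (η : θ × Module.Dual K g) :
    ∑ i, pairing K θ g (evenBasis K θ g i) η • (evenBasis K θ g).coord i =
      (pairing K θ g).flip η := by
  refine LinearMap.ext fun w => ?_
  rw [LinearMap.flip_apply]
  nth_rewrite 2 [← sum_pairing_smul_oddBasis η]
  rw [map_sum, LinearMap.sum_apply]
  simp only [map_smul, pairing_oddBasis, LinearMap.smul_apply]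

variable (K θ g) in
/-- The Euler operator `∑_i η_i ∂/∂η_i` of the odd generators. -/
def oddEuler : BigAlg K θ g →ₗ[K] BigAlg K θ g :=
  ∑ i, LinearMap.mulLeft K (odd K (oddBasis K θ g i)) ∘ₗ oddDeriv K θ g (evenBasis K θ g i)

variable (K θ g) in
/-- The Euler operator `∑_i w_i ∂/∂w_i` of the even generators. -/
def evenEuler : BigAlg K θ g →ₗ[K] BigAlg K θ g :=
  ∑ i, LinearMap.mulLeft K (even K (evenBasis K θ g i)) ∘ₗ flipDeriv (oddBasis K θ g i)

theorem oddEuler_apply (F : BigAlg K θ g) : oddEuler K θ g F =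
    ∑ i, odd K (oddBasis K θ g i) * oddDeriv K θ g (evenBasis K θ g i) F := by
  simp [oddEuler]

theorem evenEuler_apply (F : BigAlg K θ g) : evenEuler K θ g F =
    ∑ i, even K (evenBasis K θ g i) * flipDeriv (oddBasis K θ g i) F := by
  simp [evenEuler]

theorem oddEuler_mul (F G : BigAlg K θ g) :
    oddEuler K θ g (F * G) = oddEuler K θ g F * G + F * oddEuler K θ g G := by
  have h : ∀ η : θ × Module.Dual K g, odd K η * parity K θ g F = F * odd K η := by
    intro η
    induction F using induction_left with
    | one => simp
    | add F G hF hG => simp only [map_add, mul_add, add_mul, hF, hG]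
    | smul r F hF => simp only [map_smul, smul_mul_assoc, mul_smul_comm, hF]
    | even_mul v F hF =>
      rw [parity_even_mul, ← mul_assoc, ← even_mul_comm, mul_assoc, hF, mul_assoc]
    | odd_mul η' F hF =>
      rw [parity_odd_mul, mul_neg_eq, ← mul_assoc, odd_mul_odd, neg_mul_eq, neg_neg, mul_assoc, hF,
        mul_assoc]
  simp only [oddEuler_apply, oddDeriv_mul, mul_add, Finset.sum_add_distrib, Finset.sum_mul,
    Finset.mul_sum, ← mul_assoc, h]

theorem evenEuler_mul (F G : BigAlg K θ g) :
    evenEuler K θ g (F * G) = evenEuler K θ g F * G + F * evenEuler K θ g G := by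
  simp only [evenEuler_apply, flipDeriv, evenDeriv_mul, mul_add, Finset.sum_add_distrib,
    Finset.sum_mul, Finset.mul_sum, ← mul_assoc, even_mul_comm _ F]

@[simp] theorem oddEuler_even (w : g × Module.Dual K θ) : oddEuler K θ g (even K w) = 0 := by
  simp [oddEuler_apply]

@[simp] theorem evenEuler_odd (η : θ × Module.Dual K g) : evenEuler K θ g (odd K η) = 0 := by
  simp [evenEuler_apply, flipDeriv]

@[simp] theorem oddEuler_odd (η : θ × Module.Dual K g) :
    oddEuler K θ g (odd K η) = odd K η := by
  nth_rewrite 2 [← sum_pairing_smul_oddBasis η]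
  simp only [oddEuler_apply, oddDeriv_odd, mul_smul_comm, mul_one, map_sum, map_smul]

@[simp] theorem evenEuler_even (w : g × Module.Dual K θ) :
    evenEuler K θ g (even K w) = even K w := by
  nth_rewrite 2 [← sum_coord_smul_evenBasis w]
  simp only [evenEuler_apply, flipDeriv, evenDeriv_even, mul_smul_comm, mul_one, map_sum, map_smul,
    LinearMap.flip_apply, pairing_oddBasis]

theorem oddEuler_oddDeriv (w : g × Module.Dual K θ) (F : BigAlg K θ g) :
    oddEuler K θ g (oddDeriv K θ g w F) =
      oddDeriv K θ g w (oddEuler K θ g F) - oddDeriv K θ g w F := by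
  rw [oddEuler_apply, oddEuler_apply, map_sum]
  simp only [oddDeriv_odd_mul, Finset.sum_sub_distrib, pairing_oddBasis]
  rw [← oddDeriv_sum_smul, sum_coord_smul_evenBasis, sub_sub_cancel_left, ← Finset.sum_neg_distrib]
  refine Finset.sum_congr rfl fun i _ => ?_
  rw [oddDeriv_comm w, mul_neg_eq, neg_neg]

theorem evenEuler_flipDeriv (η : θ × Module.Dual K g) (F : BigAlg K θ g) :
    evenEuler K θ g (flipDeriv η F) =
      flipDeriv η (evenEuler K θ g F) - flipDeriv η F := by
  rw [evenEuler_apply, evenEuler_apply, map_sum]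
  simp only [← evenDeriv_coord]
  simp only [flipDeriv, evenDeriv_even_mul, Finset.sum_add_distrib, LinearMap.flip_apply]
  rw [← evenDeriv_sum_smul, sum_pairing_smul_coord, add_sub_cancel_left]
  exact Finset.sum_congr rfl fun i _ => by rw [evenDeriv_comm]

theorem oddEuler_flipDeriv (η : θ × Module.Dual K g) (F : BigAlg K θ g) :
    oddEuler K θ g (flipDeriv η F) = flipDeriv η (oddEuler K θ g F) := by
  simp only [oddEuler_apply, map_sum, flipDeriv, evenDeriv_odd_mul, oddDeriv_evenDeriv]

theorem evenEuler_oddDeriv (w : g × Module.Dual K θ) (F : BigAlg K θ g) :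
    evenEuler K θ g (oddDeriv K θ g w F) = oddDeriv K θ g w (evenEuler K θ g F) := by
  simp only [evenEuler_apply, map_sum, flipDeriv, oddDeriv_even_mul, oddDeriv_evenDeriv]

/-- `F` is of degree `a` in the even generators and of degree `b` in the odd ones, that is, an
eigenvector of the two Euler operators. -/
def IsHomog (a b : K) (F : BigAlg K θ g) : Prop :=
  evenEuler K θ g F = a • F ∧ oddEuler K θ g F = b • F

theorem isHomog_even (w : g × Module.Dual K θ) : IsHomog 1 0 (even K w : BigAlg K θ g) := by
  simp [IsHomog]

theorem isHomog_odd (η : θ × Module.Dual K g) : IsHomog 0 1 (odd K η : BigAlg K θ g) := by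
  simp [IsHomog]

theorem IsHomog.mul {a b a' b' : K} {F G : BigAlg K θ g} (hF : IsHomog a b F)
    (hG : IsHomog a' b' G) : IsHomog (a + a') (b + b') (F * G) := by
  constructor
  · rw [evenEuler_mul, hF.1, hG.1, smul_mul_assoc, mul_smul_comm, add_smul]
  · rw [oddEuler_mul, hF.2, hG.2, smul_mul_assoc, mul_smul_comm, add_smul]

theorem IsHomog.add {a b : K} {F G : BigAlg K θ g} (hF : IsHomog a b F) (hG : IsHomog a b G) :
    IsHomog a b (F + G) := by
  constructor
  · rw [map_add, hF.1, hG.1, smul_add]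
  · rw [map_add, hF.2, hG.2, smul_add]

theorem IsHomog.smul {a b : K} {F : BigAlg K θ g} (r : K) (hF : IsHomog a b F) :
    IsHomog a b (r • F) := by
  constructor
  · rw [map_smul, hF.1, smul_comm]
  · rw [map_smul, hF.2, smul_comm]

theorem IsHomog.sum {ι : Type*} {s : Finset ι} {a b : K} {F : ι → BigAlg K θ g}
    (h : ∀ i ∈ s, IsHomog a b (F i)) : IsHomog a b (∑ i ∈ s, F i) := by
  constructor
  · rw [map_sum, Finset.smul_sum, Finset.sum_congr rfl fun i hi => (h i hi).1]
  · rw [map_sum, Finset.smul_sum, Finset.sum_congr rfl fun i hi => (h i hi).2]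

theorem IsHomog.oddDeriv {a b : K} {F : BigAlg K θ g} (hF : IsHomog a b F)
    (w : g × Module.Dual K θ) : IsHomog a (b - 1) (oddDeriv K θ g w F) := by
  constructor
  · rw [evenEuler_oddDeriv, hF.1, map_smul]
  · rw [oddEuler_oddDeriv, hF.2, map_smul, smul_sub_self]

theorem IsHomog.flipDeriv {a b : K} {F : BigAlg K θ g} (hF : IsHomog a b F)
    (η : θ × Module.Dual K g) : IsHomog (a - 1) b (flipDeriv η F) := by
  constructor
  · rw [evenEuler_flipDeriv, hF.1, map_smul, smul_sub_self]
  · rw [oddEuler_flipDeriv, hF.2, map_smul]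

/-- An element of nonzero odd degree vanishes if its derivatives by all odd generators do. -/
theorem IsHomog.eq_zero_of_oddDeriv {a b : K} {F : BigAlg K θ g} (hF : IsHomog a b F)
    (hb : b ≠ 0) (h : ∀ w, BigAlg.oddDeriv K θ g w F = 0) : F = 0 := by
  have h2 := hF.2
  rw [oddEuler_apply] at h2
  simp only [h, mul_zero, Finset.sum_const_zero] at h2
  exact (smul_eq_zero.mp h2.symm).resolve_left hb

/-- An element of nonzero even degree vanishes if its derivatives by all even generators do. -/
theorem IsHomog.eq_zero_of_flipDeriv {a b : K} {F : BigAlg K θ g} (hF : IsHomog a b F)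
    (ha : a ≠ 0) (h : ∀ η, BigAlg.flipDeriv η F = 0) : F = 0 := by
  have h2 := hF.1
  rw [evenEuler_apply] at h2
  simp only [h, mul_zero, Finset.sum_const_zero] at h2
  exact (smul_eq_zero.mp h2.symm).resolve_left ha

theorem bigBracket_apply (F G : BigAlg K θ g) :
    bigBracket K θ g F G = ∑ i, (oddDeriv K θ g (evenBasis K θ g i) (parity K θ g F) *
      flipDeriv (oddBasis K θ g i) G +
        flipDeriv (oddBasis K θ g i) F * oddDeriv K θ g (evenBasis K θ g i) G) := by
  simp [bigBracket, evenDeriv_coord]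

theorem bigBracket_even (F : BigAlg K θ g) (w : g × Module.Dual K θ) :
    bigBracket K θ g F (even K w) = oddDeriv K θ g w (parity K θ g F) := by
  rw [bigBracket_apply]
  simp only [flipDeriv, evenDeriv_even, oddDeriv_even, mul_zero, add_zero, mul_smul_comm, mul_one,
    LinearMap.flip_apply, pairing_oddBasis]
  rw [← oddDeriv_sum_smul, sum_coord_smul_evenBasis]

theorem bigBracket_odd (F : BigAlg K θ g) (η : θ × Module.Dual K g) :
    bigBracket K θ g F (odd K η) = flipDeriv η F := by
  rw [bigBracket_apply]
  simp only [← evenDeriv_coord, evenDeriv_odd, oddDeriv_odd, mul_zero, zero_add, mul_smul_comm,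
    mul_one]
  rw [← evenDeriv_sum_smul, sum_pairing_smul_coord]
  rfl

end Euler

end BigAlg
end

noncomputable section

namespace BigAlg

/-! ### The equation `{ε, ε} = 0` -/

section MaurerCartan

variable {K θ g : Type*} [Field K] [AddCommGroup θ] [Module K θ] [AddCommGroup g] [Module K g]
  [FiniteDimensional K θ] [FiniteDimensional K g]

/-- The structure maps encoded by an element `μ + r` of `W ⊗ Λ²W' ⊕ S²W`, where `W` is the space
of even generators and `W'` that of odd ones: the bracket `B w w' = {{μ, w}, w'}` on `W` and the
map `R η = {r, η}` from `W'` to `W`. -/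
structure Encodes (μ r : BigAlg K θ g)
    (B : (g × Module.Dual K θ) →ₗ[K] (g × Module.Dual K θ) →ₗ[K] (g × Module.Dual K θ))
    (R : (θ × Module.Dual K g) →ₗ[K] (g × Module.Dual K θ)) : Prop where
  homog_left : IsHomog 1 2 μ
  homog_right : IsHomog 2 0 r
  parity_left : parity K θ g μ = μ
  parity_right : parity K θ g r = r
  oddDeriv_left : ∀ w w', oddDeriv K θ g w' (oddDeriv K θ g w μ) = -even K (B w w')
  oddDeriv_right : ∀ w, oddDeriv K θ g w r = 0
  flipDeriv_right : ∀ η, flipDeriv η r = even K (R η)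

variable {μ r : BigAlg K θ g}
    {B : (g × Module.Dual K θ) →ₗ[K] (g × Module.Dual K θ) →ₗ[K] (g × Module.Dual K θ)}
    {R : (θ × Module.Dual K g) →ₗ[K] (g × Module.Dual K θ)}

theorem Encodes.symm (h : Encodes μ r B R) (η η' : θ × Module.Dual K g) :
    pairing K θ g (R η) η' = pairing K θ g (R η') η := by
  have h1 : ∀ η η', flipDeriv η' (flipDeriv η r) = pairing K θ g (R η) η' • 1 := by
    intro η η'
    rw [h.flipDeriv_right, flipDeriv, evenDeriv_even, LinearMap.flip_apply]
  have h2 : flipDeriv η' (flipDeriv η r) = flipDeriv η (flipDeriv η' r) := evenDeriv_comm _ _ _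
  rw [h1, h1] at h2
  exact smul_one_injective h2

variable (μ r) in
/-- The part `∑_i (∂μ/∂η_i) (∂μ/∂w_i)` of `{ε, ε} / 2`, for `ε = μ + r`. -/
def selfPart : BigAlg K θ g :=
  ∑ i, oddDeriv K θ g (evenBasis K θ g i) μ * flipDeriv (oddBasis K θ g i) μ

variable (μ r) in
/-- The part `∑_i (∂μ/∂η_i) (∂r/∂w_i)` of `{ε, ε} / 2`, for `ε = μ + r`. -/
def mixedPart : BigAlg K θ g :=
  ∑ i, oddDeriv K θ g (evenBasis K θ g i) μ * flipDeriv (oddBasis K θ g i) r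

theorem Encodes.bigBracket_self (h : Encodes μ r B R) :
    bigBracket K θ g (μ + r) (μ + r) = (2 : K) • (selfPart μ + mixedPart μ r) := by
  have hp : ∀ i, parity K θ g (flipDeriv (oddBasis K θ g i) (μ + r)) =
      flipDeriv (oddBasis K θ g i) (μ + r) := by
    intro i
    rw [flipDeriv, parity_evenDeriv, map_add, h.parity_left, h.parity_right]
  rw [bigBracket_apply, two_smul, selfPart, mixedPart, ← Finset.sum_add_distrib,
    ← Finset.sum_add_distrib]
  refine Finset.sum_congr rfl fun i _ => ?_
  rw [← mul_comm_of_parity_eq (hp i), map_add, h.parity_left, h.parity_right, map_add,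
    h.oddDeriv_right, add_zero, map_add, mul_add]

theorem Encodes.selfPart_isHomog (h : Encodes μ r B R) : IsHomog 1 3 (selfPart μ) := by
  refine IsHomog.sum fun i _ => ?_
  have := (h.homog_left.oddDeriv (evenBasis K θ g i)).mul
    (h.homog_left.flipDeriv (oddBasis K θ g i))
  convert this using 1 <;> norm_num

theorem Encodes.mixedPart_isHomog (h : Encodes μ r B R) : IsHomog 2 1 (mixedPart μ r) := by
  refine IsHomog.sum fun i _ => ?_
  have := (h.homog_left.oddDeriv (evenBasis K θ g i)).mul
    (h.homog_right.flipDeriv (oddBasis K θ g i))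
  convert this using 1 <;> norm_num

theorem Encodes.oddDeriv_mixedPart (h : Encodes μ r B R) (w : g × Module.Dual K θ) :
    oddDeriv K θ g w (mixedPart μ r) =
      -∑ i, even K (B (evenBasis K θ g i) w) * even K (R (oddBasis K θ g i)) := by
  rw [mixedPart, map_sum, ← Finset.sum_neg_distrib]
  refine Finset.sum_congr rfl fun i _ => ?_
  rw [oddDeriv_mul, h.oddDeriv_left, flipDeriv, oddDeriv_evenDeriv, h.oddDeriv_right, map_zero,
    mul_zero, add_zero, neg_mul_eq, ← flipDeriv, h.flipDeriv_right]

theorem sum_coord_smul_apply {X : Type*} [AddCommGroup X] [Module K X]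
    (f : (g × Module.Dual K θ) →ₗ[K] X) (w : g × Module.Dual K θ) :
    ∑ i, (evenBasis K θ g).coord i w • f (evenBasis K θ g i) = f w := by
  conv_rhs => rw [← sum_coord_smul_evenBasis w]
  simp only [map_sum, map_smul]

theorem Encodes.flipDeriv_oddDeriv_mixedPart (h : Encodes μ r B R) (w : g × Module.Dual K θ)
    (η η' : θ × Module.Dual K g) :
    flipDeriv η' (flipDeriv η (oddDeriv K θ g w (mixedPart μ r))) =
      -((pairing K θ g (B (R η) w) η' + pairing K θ g (B (R η') w) η) • 1) := by
  have key : ∀ η η', ∑ i, pairing K θ g (B (evenBasis K θ g i) w) η *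
      pairing K θ g (R (oddBasis K θ g i)) η' = pairing K θ g (B (R η') w) η := by
    intro η η'
    have h1 := sum_coord_smul_apply (((pairing K θ g).flip η) ∘ₗ B.flip w) (R η')
    simp only [LinearMap.comp_apply, LinearMap.flip_apply] at h1
    rw [← h1]
    refine Finset.sum_congr rfl fun i _ => ?_
    rw [h.symm, pairing_oddBasis, mul_comm, smul_eq_mul]
  rw [h.oddDeriv_mixedPart, map_neg, map_neg, map_sum, map_sum, ← key η η', ← key η' η,
    ← Finset.sum_add_distrib, Finset.sum_smul]
  refine congrArg _ (Finset.sum_congr rfl fun i _ => ?_)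
  simp only [flipDeriv, evenDeriv_even_mul, evenDeriv_even, map_add, map_smul,
    LinearMap.flip_apply, mul_smul_comm, mul_one, smul_smul,
    add_smul]
  rw [add_comm, mul_comm (pairing K θ g (R (oddBasis K θ g i)) η)]

theorem Encodes.oddDeriv_selfPart (h : Encodes μ r B R) (a : g × Module.Dual K θ) :
    oddDeriv K θ g a (selfPart μ) =
      -∑ i, (even K (B (evenBasis K θ g i) a) * flipDeriv (oddBasis K θ g i) μ +
        oddDeriv K θ g (evenBasis K θ g i) μ *
          flipDeriv (oddBasis K θ g i) (oddDeriv K θ g a μ)) := by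
  rw [selfPart, map_sum, ← Finset.sum_neg_distrib]
  refine Finset.sum_congr rfl fun i _ => ?_
  rw [oddDeriv_mul, h.oddDeriv_left, flipDeriv, oddDeriv_evenDeriv, parity_oddDeriv,
    h.parity_left, neg_mul_eq, neg_mul_eq, neg_add]

theorem Encodes.oddDeriv_flipDeriv (h : Encodes μ r B R)
    (i : Fin (Module.finrank K (g × Module.Dual K θ))) (w w' : g × Module.Dual K θ) :
    oddDeriv K θ g w' (flipDeriv (oddBasis K θ g i) (oddDeriv K θ g w μ)) =
      -((evenBasis K θ g).coord i (B w w') • 1) := by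
  rw [flipDeriv, oddDeriv_evenDeriv, h.oddDeriv_left, map_neg, evenDeriv_even,
    LinearMap.flip_apply, pairing_oddBasis]

theorem Encodes.oddDeriv_oddDeriv_selfPart (h : Encodes μ r B R) (a b : g × Module.Dual K θ) :
    oddDeriv K θ g b (oddDeriv K θ g a (selfPart μ)) =
      -(∑ i, (even K (B (evenBasis K θ g i) a) * flipDeriv (oddBasis K θ g i)
          (oddDeriv K θ g b μ) -
        even K (B (evenBasis K θ g i) b) * flipDeriv (oddBasis K θ g i) (oddDeriv K θ g a μ)) +
        oddDeriv K θ g (B a b) μ) := by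
  have h1 : oddDeriv K θ g (B a b) μ = ∑ i, (evenBasis K θ g).coord i (B a b) •
      oddDeriv K θ g (evenBasis K θ g i) μ := by
    rw [← oddDeriv_sum_smul, sum_coord_smul_evenBasis]
  rw [h1, h.oddDeriv_selfPart, map_neg, map_sum, ← Finset.sum_add_distrib]
  refine congrArg _ (Finset.sum_congr rfl fun i _ => ?_)
  have h2 : oddDeriv K θ g b (even K (B (evenBasis K θ g i) a) *
      flipDeriv (oddBasis K θ g i) μ) = even K (B (evenBasis K θ g i) a) *
        flipDeriv (oddBasis K θ g i) (oddDeriv K θ g b μ) := by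
    rw [oddDeriv_even_mul, flipDeriv, oddDeriv_evenDeriv]
  have h3 : oddDeriv K θ g b (oddDeriv K θ g (evenBasis K θ g i) μ *
      flipDeriv (oddBasis K θ g i) (oddDeriv K θ g a μ)) =
      -(even K (B (evenBasis K θ g i) b) *
        flipDeriv (oddBasis K θ g i) (oddDeriv K θ g a μ)) +
      (evenBasis K θ g).coord i (B a b) • oddDeriv K θ g (evenBasis K θ g i) μ := by
    rw [oddDeriv_mul, h.oddDeriv_left, parity_oddDeriv, h.parity_left, h.oddDeriv_flipDeriv,
      neg_mul_eq, neg_mul_eq, mul_neg_eq, neg_neg, mul_smul_comm, mul_one]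
  rw [map_add, h2, h3, ← add_assoc]
  exact congrArg (· + _) (sub_eq_add_neg _ _).symm

theorem Encodes.oddDeriv_oddDeriv_oddDeriv_selfPart (h : Encodes μ r B R)
    (a b c : g × Module.Dual K θ) :
    oddDeriv K θ g c (oddDeriv K θ g b (oddDeriv K θ g a (selfPart μ))) =
      even K (B (B b c) a - B (B a c) b + B (B a b) c) := by
  have h3 : ∀ i, oddDeriv K θ g c (even K (B (evenBasis K θ g i) a) *
        flipDeriv (oddBasis K θ g i) (oddDeriv K θ g b μ) -
        even K (B (evenBasis K θ g i) b) * flipDeriv (oddBasis K θ g i) (oddDeriv K θ g a μ)) =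
      (evenBasis K θ g).coord i (B a c) • even K (B (evenBasis K θ g i) b) -
      (evenBasis K θ g).coord i (B b c) • even K (B (evenBasis K θ g i) a) := by
    intro i
    rw [map_sub, oddDeriv_even_mul, oddDeriv_even_mul, h.oddDeriv_flipDeriv,
      h.oddDeriv_flipDeriv, mul_neg_eq, mul_neg_eq,
      mul_smul_comm, mul_smul_comm, mul_one, mul_one]
    exact neg_sub_neg _ _
  have h4 := sum_coord_smul_apply (even K ∘ₗ B.flip b) (B a c)
  have h5 := sum_coord_smul_apply (even K ∘ₗ B.flip a) (B b c)
  simp only [LinearMap.comp_apply, LinearMap.flip_apply] at h4 h5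
  rw [h.oddDeriv_oddDeriv_selfPart, map_neg, map_add, h.oddDeriv_left, map_sum,
    Finset.sum_congr rfl fun i _ => h3 i, Finset.sum_sub_distrib, h4, h5, map_add, map_sub]
  abel

/-- The equation `{ε, ε} = 0` for `ε = μ + r` says that `B` satisfies the Jacobi identity and that
`r`, as a symmetric tensor, is invariant under the adjoint action of `B`. The two conditions are
separated by the bidegree. -/
theorem Encodes.bigBracket_self_eq_zero_iff [CharZero K] (h : Encodes μ r B R) :
    bigBracket K θ g (μ + r) (μ + r) = 0 ↔
      (∀ a b c, B (B b c) a - B (B a c) b + B (B a b) c = 0) ∧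
      ∀ w η η', pairing K θ g (B (R η) w) η' + pairing K θ g (B (R η') w) η = 0 := by
  have hmix : ∀ a b c, oddDeriv K θ g c (oddDeriv K θ g b
      (oddDeriv K θ g a (mixedPart μ r))) = 0 := by
    intro a b c
    rw [h.oddDeriv_mixedPart, map_neg, map_sum]
    simp
  have hself : selfPart μ = 0 ↔ ∀ a b c, B (B b c) a - B (B a c) b + B (B a b) c = 0 := by
    constructor
    · intro h0 a b c
      apply even_injective (K := K)
      rw [← h.oddDeriv_oddDeriv_oddDeriv_selfPart, h0]
      simp
    · intro hJ
      have hh := h.selfPart_isHomog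
      refine hh.eq_zero_of_oddDeriv (by norm_num) fun a => ?_
      refine (hh.oddDeriv a).eq_zero_of_oddDeriv (by norm_num) fun b => ?_
      refine ((hh.oddDeriv a).oddDeriv b).eq_zero_of_oddDeriv (by norm_num) fun c => ?_
      rw [h.oddDeriv_oddDeriv_oddDeriv_selfPart, hJ, map_zero]
  have hmixed : mixedPart μ r = 0 ↔
      ∀ w η η', pairing K θ g (B (R η) w) η' + pairing K θ g (B (R η') w) η = 0 := by
    constructor
    · intro h0 w η η'
      have h1 := h.flipDeriv_oddDeriv_mixedPart w η η'
      rw [h0, map_zero, map_zero, map_zero, eq_comm, neg_eq_zero] at h1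
      exact smul_one_injective (h1.trans (zero_smul K _).symm)
    · intro hI
      have hh := h.mixedPart_isHomog
      refine hh.eq_zero_of_oddDeriv (by norm_num) fun w => ?_
      refine (hh.oddDeriv w).eq_zero_of_flipDeriv (by norm_num) fun η => ?_
      refine ((hh.oddDeriv w).flipDeriv η).eq_zero_of_flipDeriv (by norm_num) fun η' => ?_
      rw [h.flipDeriv_oddDeriv_mixedPart, hI, zero_smul, neg_zero]
  rw [h.bigBracket_self, smul_eq_zero, or_iff_right (two_ne_zero : (2 : K) ≠ 0), ← hself, ← hmixed]
  constructor
  · intro h0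
    have h1 : selfPart μ = 0 := by
      rw [hself]
      intro a b c
      apply even_injective (K := K)
      have h2 : oddDeriv K θ g c (oddDeriv K θ g b
          (oddDeriv K θ g a (selfPart μ + mixedPart μ r))) = 0 := by
        rw [h0]; simp
      rw [map_add, map_add, map_add, hmix, add_zero, h.oddDeriv_oddDeriv_oddDeriv_selfPart] at h2
      rw [h2, map_zero]
    refine ⟨h1, ?_⟩
    rwa [h1, zero_add] at h0
  · rintro ⟨h1, h2⟩
    rw [h1, h2, add_zero]

end MaurerCartan

end BigAlg
end

noncomputable section

namespace BigAlg

/-! ### Cubic and quadratic elements from structure maps -/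

section Elements

theorem sum_coord_smul_bilin {K V V' X ι ι' : Type*} [Field K] [AddCommGroup V] [Module K V]
    [AddCommGroup V'] [Module K V'] [AddCommGroup X] [Module K X] [Fintype ι] [Fintype ι']
    (b : Module.Basis ι K V) (c : Module.Basis ι' K V') (f : V →ₗ[K] V' →ₗ[K] X) (x : V) (y : V') :
    ∑ i, ∑ j, (b.coord i x * c.coord j y) • f (b i) (c j) = f x y := by
  conv_rhs => rw [← b.sum_repr x, ← c.sum_repr y]
  simp only [map_sum, map_smul, LinearMap.sum_apply, LinearMap.smul_apply, Finset.smul_sum,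
    mul_smul]
  rw [Finset.sum_comm]
  exact Finset.sum_congr rfl fun j _ => Finset.sum_congr rfl fun i _ => smul_comm _ _ _

theorem coord_dualBasis {K V ι : Type*} [Field K] [AddCommGroup V] [Module K V] [Finite ι]
    [DecidableEq ι] (b : Module.Basis ι K V) (i : ι) (α : Module.Dual K V) :
    b.dualBasis.coord i α = α (b i) := by
  simp

theorem sum_apply_smul_coord {K V ι : Type*} [Field K] [AddCommGroup V] [Module K V] [Fintype ι]
    (b : Module.Basis ι K V) (α : Module.Dual K V) : ∑ i, α (b i) • b.coord i = α := by
  classical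
  refine b.ext fun j => ?_
  simp

variable {K θ g : Type*} [Field K] [AddCommGroup θ] [Module K θ] [AddCommGroup g] [Module K g]

/-- The monomial `η η' v` in two odd generators and an even one. -/
def mono (η η' : θ × Module.Dual K g) (v : g × Module.Dual K θ) : BigAlg K θ g :=
  odd K η * odd K η' * even K v

/-- The bracket `{{η η' v, w}, w'}` on the even generators that is derived from `η η' v`. -/
def monoBracket (η η' : θ × Module.Dual K g) (v : g × Module.Dual K θ) :
    (g × Module.Dual K θ) →ₗ[K] (g × Module.Dual K θ) →ₗ[K] (g × Module.Dual K θ) :=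
  ((pairing K θ g).flip η').smulRight (((pairing K θ g).flip η).smulRight v) +
    (-1 : K) • ((pairing K θ g).flip η).smulRight (((pairing K θ g).flip η').smulRight v)

theorem monoBracket_apply (η η' : θ × Module.Dual K g) (v w w' : g × Module.Dual K θ) :
    monoBracket η η' v w w' = (pairing K θ g w η' * pairing K θ g w' η -
      pairing K θ g w η * pairing K θ g w' η') • v := by
  simp only [monoBracket, LinearMap.add_apply, LinearMap.smul_apply, LinearMap.smulRight_apply,
    LinearMap.flip_apply, smul_smul, ← add_smul]
  ring_nf

variable [FiniteDimensional K θ] [FiniteDimensional K g]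

/-- `μ` is an even element of `W ⊗ Λ²W'`, where `W` is the space of even generators and `W'` that
of odd ones, and `B w w' = {{μ, w}, w'}` is its derived bracket on `W`. -/
structure Derives (μ : BigAlg K θ g)
    (B : (g × Module.Dual K θ) →ₗ[K] (g × Module.Dual K θ) →ₗ[K] (g × Module.Dual K θ)) :
    Prop where
  homog : IsHomog 1 2 μ
  parity_eq : parity K θ g μ = μ
  oddDeriv_oddDeriv : ∀ w w', oddDeriv K θ g w' (oddDeriv K θ g w μ) = -even K (B w w')

theorem derives_mono (η η' : θ × Module.Dual K g) (v : g × Module.Dual K θ) :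
    Derives (mono η η' v) (monoBracket η η' v) where
  homog := by
    have := ((isHomog_odd η).mul (isHomog_odd η')).mul (isHomog_even v)
    convert this using 1 <;> norm_num [mono]
  parity_eq := by
    rw [mono, mul_assoc, parity_odd_mul, parity_odd_mul, parity_even, mul_neg_eq, neg_neg]
  oddDeriv_oddDeriv w w' := by
    rw [mono, mul_assoc, oddDeriv_odd_mul, oddDeriv_odd_mul, oddDeriv_even, mul_zero, sub_zero,
      map_sub, mul_smul_comm, map_smul, map_smul, oddDeriv_odd_mul, oddDeriv_odd_mul,
      oddDeriv_even, mul_zero, mul_zero, sub_zero, sub_zero, monoBracket_apply, map_smul, smul_smul,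
      smul_smul]
    have key {X : Type _} [AddCommGroup X] [Module K X] (a b : K) (x : X) :
        a • x - b • x = -((b - a) • x) := by rw [← neg_smul, neg_sub, sub_smul]
    exact key _ _ (even K v)

theorem Derives.add {μ μ' : BigAlg K θ g}
    {B B' : (g × Module.Dual K θ) →ₗ[K] (g × Module.Dual K θ) →ₗ[K] (g × Module.Dual K θ)}
    (h : Derives μ B) (h' : Derives μ' B') : Derives (μ + μ') (B + B') where
  homog := h.homog.add h'.homog
  parity_eq := by rw [map_add, h.parity_eq, h'.parity_eq]
  oddDeriv_oddDeriv w w' := by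
    rw [map_add, map_add, h.oddDeriv_oddDeriv, h'.oddDeriv_oddDeriv, LinearMap.add_apply,
      LinearMap.add_apply, map_add, neg_add]

theorem Derives.smul {μ : BigAlg K θ g}
    {B : (g × Module.Dual K θ) →ₗ[K] (g × Module.Dual K θ) →ₗ[K] (g × Module.Dual K θ)}
    (r : K) (h : Derives μ B) : Derives (r • μ) (r • B) where
  homog := h.homog.smul r
  parity_eq := by rw [map_smul, h.parity_eq]
  oddDeriv_oddDeriv w w' := by
    rw [map_smul, map_smul, h.oddDeriv_oddDeriv, LinearMap.smul_apply, LinearMap.smul_apply,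
      map_smul, smul_neg]

theorem Derives.sum {ι : Type*} {s : Finset ι} {μ : ι → BigAlg K θ g}
    {B : ι → (g × Module.Dual K θ) →ₗ[K] (g × Module.Dual K θ) →ₗ[K] (g × Module.Dual K θ)}
    (h : ∀ i ∈ s, Derives (μ i) (B i)) : Derives (∑ i ∈ s, μ i) (∑ i ∈ s, B i) where
  homog := IsHomog.sum fun i hi => (h i hi).homog
  parity_eq := by rw [map_sum, Finset.sum_congr rfl fun i hi => (h i hi).parity_eq]
  oddDeriv_oddDeriv w w' := by
    rw [map_sum, map_sum, Finset.sum_congr rfl fun i hi => (h i hi).oddDeriv_oddDeriv w w']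
    simp only [LinearMap.sum_apply, map_sum, Finset.sum_neg_distrib]

theorem Derives.bigBracket_even_even {μ : BigAlg K θ g}
    {B : (g × Module.Dual K θ) →ₗ[K] (g × Module.Dual K θ) →ₗ[K] (g × Module.Dual K θ)}
    (h : Derives μ B) (w w' : g × Module.Dual K θ) :
    bigBracket K θ g (bigBracket K θ g μ (even K w)) (even K w') = even K (B w w') := by
  rw [bigBracket_even, bigBracket_even, parity_oddDeriv, h.parity_eq, h.parity_eq, map_neg,
    h.oddDeriv_oddDeriv, neg_neg]

/-- The derived bracket with an odd generator is dual to the derived bracket on even ones. -/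
theorem Derives.bigBracket_even_odd {μ : BigAlg K θ g}
    {B : (g × Module.Dual K θ) →ₗ[K] (g × Module.Dual K θ) →ₗ[K] (g × Module.Dual K θ)}
    (h : Derives μ B) (w : g × Module.Dual K θ) (η ζ : θ × Module.Dual K g)
    (hζ : ∀ w', pairing K θ g w' ζ = -pairing K θ g (B w w') η) :
    bigBracket K θ g (bigBracket K θ g μ (even K w)) (odd K η) = odd K ζ := by
  rw [bigBracket_even, bigBracket_odd, h.parity_eq, ← sub_eq_zero]
  have h1 : IsHomog 0 1 (flipDeriv η (oddDeriv K θ g w μ) + (-1 : K) • odd K ζ) := by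
    have := (h.homog.oddDeriv w).flipDeriv η
    refine IsHomog.add ?_ ((isHomog_odd ζ).smul _)
    convert this using 1 <;> norm_num
  have h2 := h1.eq_zero_of_oddDeriv one_ne_zero fun w' => by
    rw [map_add, flipDeriv, oddDeriv_evenDeriv, h.oddDeriv_oddDeriv, map_neg, evenDeriv_even,
      LinearMap.flip_apply, map_smul, oddDeriv_odd, hζ, smul_smul, neg_one_mul, neg_neg]
    exact neg_add_cancel _
  rw [← h2]
  exact (sub_eq_add_neg _ _).trans (congrArg _ (neg_one_smul K _).symm)

/-- The element of `(⊙²𝔤*) ⊙ 𝔤` of an alternating bracket on `𝔤`. Every pair of basis vectors occurs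
twice in the sum, whence the factor `1/2`; the sign makes `{{baseElt β, x}, y} = β x y`. -/
def baseElt (β : g →ₗ[K] g →ₗ[K] g) : BigAlg K θ g :=
  ∑ i, ∑ j, (-2⁻¹ : K) • mono (0, (Module.finBasis K g).coord i) (0, (Module.finBasis K g).coord j)
    (β (Module.finBasis K g i) (Module.finBasis K g j), 0)

/-- The element of `𝔤* ⊙ θ* ⊙ θ` of a bilinear map `𝔤 × θ → θ`. -/
def actElt (ρ : g →ₗ[K] θ →ₗ[K] θ) : BigAlg K θ g :=
  ∑ i, ∑ j, mono (0, (Module.finBasis K g).coord i)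
    (ρ (Module.finBasis K g i) (Module.finBasis K θ j), 0) (0, (Module.finBasis K θ).coord j)

/-- The element of `θ* ⊙ (⊙²θ)` of an alternating bracket on `θ*`. -/
def dualBaseElt (γ : Module.Dual K θ →ₗ[K] Module.Dual K θ →ₗ[K] Module.Dual K θ) :
    BigAlg K θ g :=
  ∑ i, ∑ j, (-2⁻¹ : K) • mono (Module.finBasis K θ i, 0) (Module.finBasis K θ j, 0)
    (0, γ ((Module.finBasis K θ).coord i) ((Module.finBasis K θ).coord j))

/-- The element of `𝔤* ⊙ θ ⊙ 𝔤` of a bilinear map `θ* × 𝔤* → 𝔤*`. -/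
def dualActElt (σ : Module.Dual K θ →ₗ[K] Module.Dual K g →ₗ[K] Module.Dual K g) :
    BigAlg K θ g :=
  ∑ i, ∑ j, (-1 : K) • mono (0, σ ((Module.finBasis K θ).coord i) ((Module.finBasis K g).coord j))
    (Module.finBasis K θ i, 0) (Module.finBasis K g j, 0)

/-- The element of `θ* ⊙ 𝔤` of a linear map `θ → 𝔤`. -/
def mapElt (φ : θ →ₗ[K] g) : BigAlg K θ g :=
  ∑ j, even K (0, (Module.finBasis K θ).coord j) * even K (φ (Module.finBasis K θ j), 0)

/-- The derived bracket of `baseElt β` on the even generators `𝔤 × θ*` is `β` on `𝔤` and zero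
otherwise; it is specified by its pairings with the odd generators. -/
theorem exists_derives_baseElt [CharZero K] (β : g →ₗ[K] g →ₗ[K] g) (hβ : ∀ x, β x x = 0) :
    ∃ B, Derives (baseElt β : BigAlg K θ g) B ∧
      ∀ w w' η, pairing K θ g (B w w') η = η.2 (β w.1 w'.1) := by
  refine ⟨_, Derives.sum fun i _ => Derives.sum fun j _ => (derives_mono _ _ _).smul _, ?_⟩
  intro w w' η
  have hs : β w'.1 w.1 = -β w.1 w'.1 := skew_of_self hβ _ _
  have h1 := sum_coord_smul_bilin (Module.finBasis K g) (Module.finBasis K g)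
    (β.compr₂ η.2) w.1 w'.1
  have h2 := sum_coord_smul_bilin (Module.finBasis K g) (Module.finBasis K g)
    (β.compr₂ η.2) w'.1 w.1
  have h3 : η.2 (β w.1 w'.1) = (2⁻¹ : K) * (η.2 (β w.1 w'.1) - η.2 (β w'.1 w.1)) := by
    rw [hs, map_neg]; field_simp; ring
  simp only [LinearMap.compr₂_apply] at h1 h2
  rw [h3, ← h1, ← h2, ← Finset.sum_sub_distrib, Finset.mul_sum]
  simp only [← Finset.sum_sub_distrib, Finset.mul_sum, LinearMap.sum_apply, map_sum,
    LinearMap.smul_apply, map_smul, monoBracket_apply]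
  refine Finset.sum_congr rfl fun i _ => Finset.sum_congr rfl fun j _ => ?_
  simp only [pairing_apply, smul_eq_mul, map_zero, add_zero,
    LinearMap.zero_apply]
  ring

/-- The derived bracket of `actElt ρ` is the contragredient `(x, κ) ↦ -κ ∘ ρ x` of `ρ`, extended
antisymmetrically to `𝔤 × θ*`. -/
theorem exists_derives_actElt (ρ : g →ₗ[K] θ →ₗ[K] θ) :
    ∃ B, Derives (actElt ρ : BigAlg K θ g) B ∧
      ∀ w w' η, pairing K θ g (B w w') η = w.2 (ρ w'.1 η.1) - w'.2 (ρ w.1 η.1) := by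
  refine ⟨_, Derives.sum fun i _ => Derives.sum fun j _ => derives_mono _ _ _, ?_⟩
  intro w w' η
  have h1 := sum_coord_smul_bilin (Module.finBasis K g) (Module.finBasis K θ)
    (ρ.compr₂ w.2) w'.1 η.1
  have h2 := sum_coord_smul_bilin (Module.finBasis K g) (Module.finBasis K θ)
    (ρ.compr₂ w'.2) w.1 η.1
  simp only [LinearMap.compr₂_apply] at h1 h2
  rw [← h1, ← h2, ← Finset.sum_sub_distrib]
  simp only [← Finset.sum_sub_distrib, LinearMap.sum_apply, map_sum,
    LinearMap.smul_apply, map_smul, monoBracket_apply]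
  refine Finset.sum_congr rfl fun i _ => Finset.sum_congr rfl fun j _ => ?_
  simp only [pairing_apply, smul_eq_mul, map_zero, add_zero, zero_add,
    LinearMap.zero_apply]
  ring

theorem exists_derives_dualBaseElt [CharZero K]
    (γ : Module.Dual K θ →ₗ[K] Module.Dual K θ →ₗ[K] Module.Dual K θ) (hγ : ∀ κ, γ κ κ = 0) :
    ∃ B, Derives (dualBaseElt γ : BigAlg K θ g) B ∧
      ∀ w w' η, pairing K θ g (B w w') η = γ w.2 w'.2 η.1 := by
  refine ⟨_, Derives.sum fun i _ => Derives.sum fun j _ => (derives_mono _ _ _).smul _, ?_⟩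
  intro w w' η
  have hs : γ w'.2 w.2 = -γ w.2 w'.2 := skew_of_self hγ _ _
  have h1 := sum_coord_smul_bilin (Module.finBasis K θ).dualBasis (Module.finBasis K θ).dualBasis
    (γ.compr₂ (Module.Dual.eval K θ η.1)) w.2 w'.2
  have h2 := sum_coord_smul_bilin (Module.finBasis K θ).dualBasis (Module.finBasis K θ).dualBasis
    (γ.compr₂ (Module.Dual.eval K θ η.1)) w'.2 w.2
  simp only [LinearMap.compr₂_apply, Module.Dual.eval_apply, coord_dualBasis,
    Module.Basis.coe_dualBasis] at h1 h2
  have h3 : γ w.2 w'.2 η.1 = (2⁻¹ : K) * (γ w.2 w'.2 η.1 - γ w'.2 w.2 η.1) := by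
    rw [hs, LinearMap.neg_apply]; field_simp; ring
  rw [h3, ← h1, ← h2, ← Finset.sum_sub_distrib, Finset.mul_sum]
  simp only [← Finset.sum_sub_distrib, Finset.mul_sum, LinearMap.sum_apply, map_sum,
    LinearMap.smul_apply, map_smul, monoBracket_apply]
  refine Finset.sum_congr rfl fun i _ => Finset.sum_congr rfl fun j _ => ?_
  simp only [pairing_apply, smul_eq_mul, map_zero, zero_add, LinearMap.zero_apply]
  ring

/-- The derived bracket of `dualActElt σ` is the contragredient of `σ`, a map `θ* × 𝔤 → 𝔤`,
extended antisymmetrically to `𝔤 × θ*`. -/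
theorem exists_derives_dualActElt
    (σ : Module.Dual K θ →ₗ[K] Module.Dual K g →ₗ[K] Module.Dual K g) :
    ∃ B, Derives (dualActElt σ : BigAlg K θ g) B ∧
      ∀ w w' η, pairing K θ g (B w w') η = σ w'.2 η.2 w.1 - σ w.2 η.2 w'.1 := by
  refine ⟨_, Derives.sum fun i _ => Derives.sum fun j _ => (derives_mono _ _ _).smul _, ?_⟩
  intro w w' η
  have h1 := sum_coord_smul_bilin (Module.finBasis K θ).dualBasis (Module.finBasis K g).dualBasis
    (σ.compr₂ (Module.Dual.eval K g w.1)) w'.2 η.2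
  have h2 := sum_coord_smul_bilin (Module.finBasis K θ).dualBasis (Module.finBasis K g).dualBasis
    (σ.compr₂ (Module.Dual.eval K g w'.1)) w.2 η.2
  simp only [LinearMap.compr₂_apply, Module.Dual.eval_apply, coord_dualBasis,
    Module.Basis.coe_dualBasis] at h1 h2
  rw [← h1, ← h2, ← Finset.sum_sub_distrib]
  simp only [← Finset.sum_sub_distrib, LinearMap.sum_apply, map_sum,
    LinearMap.smul_apply, map_smul, monoBracket_apply]
  refine Finset.sum_congr rfl fun i _ => Finset.sum_congr rfl fun j _ => ?_
  simp only [pairing_apply, smul_eq_mul, map_zero, zero_add, add_zero, LinearMap.zero_apply]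
  ring

omit [FiniteDimensional K g] in
theorem flipDeriv_mapElt (φ : θ →ₗ[K] g) (η : θ × Module.Dual K g) :
    flipDeriv η (mapElt φ : BigAlg K θ g) = even K (φ η.1, η.2 ∘ₗ φ) := by
  have h1 : φ η.1 = ∑ j, (Module.finBasis K θ).coord j η.1 • φ (Module.finBasis K θ j) := by
    conv_lhs => rw [← (Module.finBasis K θ).sum_repr η.1]
    simp only [map_sum, map_smul]
    rfl
  have h2 := sum_apply_smul_coord (Module.finBasis K θ) (η.2 ∘ₗ φ)
  have h3 : (φ η.1, η.2 ∘ₗ φ) = ∑ j, ((Module.finBasis K θ).coord j η.1 •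
      (φ (Module.finBasis K θ j), (0 : Module.Dual K θ)) +
      η.2 (φ (Module.finBasis K θ j)) • ((0 : g), (Module.finBasis K θ).coord j)) := by
    rw [h1, ← h2]
    exact Prod.ext (by simp [Prod.fst_sum]) (by simp [Prod.snd_sum])
  rw [h3, mapElt, map_sum, map_sum]
  refine Finset.sum_congr rfl fun j _ => ?_
  rw [flipDeriv, evenDeriv_even_mul, evenDeriv_even, map_add, map_smul, map_smul, mul_smul_comm,
    mul_one]
  simp only [LinearMap.flip_apply, pairing_apply, map_zero, zero_add, add_zero,
    LinearMap.zero_apply]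

theorem isHomog_mapElt (φ : θ →ₗ[K] g) : IsHomog 2 0 (mapElt φ : BigAlg K θ g) := by
  refine IsHomog.sum fun j _ => ?_
  have := (isHomog_even (K := K) (0, (Module.finBasis K θ).coord j)).mul
    (isHomog_even (K := K) (φ (Module.finBasis K θ j), (0 : Module.Dual K θ)))
  convert this using 1 <;> norm_num

end Elements

end BigAlg
end

noncomputable section

namespace BigAlg

/-! ### The components of `S(V[2] ⊕ V*[1])` in terms of structure maps -/

section Components

variable {K θ g : Type*} [Field K] [AddCommGroup θ] [Module K θ] [AddCommGroup g] [Module K g]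

theorem mono_eq_mul_mul (η η' : θ × Module.Dual K g) (v : g × Module.Dual K θ) :
    mono η η' v = odd K η * even K v * odd K η' := by
  rw [mono, mul_assoc, mul_assoc, even_mul_comm]

theorem mono_eq_even_mul (η η' : θ × Module.Dual K g) (v : g × Module.Dual K θ) :
    mono η η' v = even K v * (odd K η * odd K η') := by
  rw [mono, even_mul_comm]

variable (K θ g) in
theorem component_one_two_zero_zero : component K θ g 1 2 0 0 =
    LinearMap.range (ofBaseDual K θ g) * LinearMap.range (ofBaseDual K θ g) *
      LinearMap.range (ofBase K θ g) := by
  have key {A : Type _} [Semiring A] [Algebra K A] (P Q R S : Submodule K A) :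
      P ^ 2 * Q ^ 0 * R ^ 0 * S ^ 1 = P * P * S := by
    simp only [pow_zero, mul_one, pow_one, pow_two]
  exact key _ _ _ _

variable (K θ g) in
theorem component_zero_one_one_one : component K θ g 0 1 1 1 =
    LinearMap.range (ofBaseDual K θ g) * LinearMap.range (ofTopDual K θ g) *
      LinearMap.range (ofTop K θ g) := by
  have key {A : Type _} [Semiring A] [Algebra K A] (P Q R S : Submodule K A) :
      P ^ 1 * Q ^ 1 * R ^ 1 * S ^ 0 = P * Q * R := by
    simp only [pow_zero, mul_one, pow_one]
  exact key _ _ _ _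

variable (K θ g) in
theorem component_zero_zero_two_one : component K θ g 0 0 2 1 =
    LinearMap.range (ofTopDual K θ g) *
      (LinearMap.range (ofTop K θ g) * LinearMap.range (ofTop K θ g)) := by
  have key {A : Type _} [Semiring A] [Algebra K A] (P Q R S : Submodule K A) :
      P ^ 0 * Q ^ 1 * R ^ 2 * S ^ 0 = Q * (R * R) := by
    simp only [pow_zero, mul_one, one_mul, pow_one, pow_two]
  exact key _ _ _ _

variable (K θ g) in
theorem component_one_one_one_zero : component K θ g 1 1 1 0 =
    LinearMap.range (ofBaseDual K θ g) * LinearMap.range (ofTop K θ g) *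
      LinearMap.range (ofBase K θ g) := by
  have key {A : Type _} [Semiring A] [Algebra K A] (P Q R S : Submodule K A) :
      P ^ 1 * Q ^ 0 * R ^ 1 * S ^ 1 = P * R * S := by
    simp only [pow_zero, mul_one, pow_one]
  exact key _ _ _ _

variable (K θ g) in
theorem component_one_zero_zero_one : component K θ g 1 0 0 1 =
    LinearMap.range (ofTopDual K θ g) * LinearMap.range (ofBase K θ g) := by
  have key {A : Type _} [Semiring A] [Algebra K A] (P Q R S : Submodule K A) :
      P ^ 0 * Q ^ 1 * R ^ 0 * S ^ 1 = Q * S := by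
    simp only [pow_zero, mul_one, one_mul, pow_one]
  exact key _ _ _ _

variable [FiniteDimensional K θ] [FiniteDimensional K g]

omit [FiniteDimensional K θ] in
theorem baseElt_mem (β : g →ₗ[K] g →ₗ[K] g) :
    (baseElt β : BigAlg K θ g) ∈ component K θ g 1 2 0 0 := by
  rw [component_one_two_zero_zero]
  refine Submodule.sum_mem _ fun i _ => Submodule.sum_mem _ fun j _ => Submodule.smul_mem _ _ ?_
  exact Submodule.mul_mem_mul (Submodule.mul_mem_mul ⟨_, rfl⟩ ⟨_, rfl⟩) ⟨_, rfl⟩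

theorem actElt_mem (ρ : g →ₗ[K] θ →ₗ[K] θ) :
    (actElt ρ : BigAlg K θ g) ∈ component K θ g 0 1 1 1 := by
  rw [component_zero_one_one_one]
  refine Submodule.sum_mem _ fun i _ => Submodule.sum_mem _ fun j _ => ?_
  rw [mono_eq_mul_mul]
  exact Submodule.mul_mem_mul (Submodule.mul_mem_mul ⟨_, rfl⟩ ⟨_, rfl⟩) ⟨_, rfl⟩

omit [FiniteDimensional K g] in
theorem dualBaseElt_mem (γ : Module.Dual K θ →ₗ[K] Module.Dual K θ →ₗ[K] Module.Dual K θ) :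
    (dualBaseElt γ : BigAlg K θ g) ∈ component K θ g 0 0 2 1 := by
  rw [component_zero_zero_two_one]
  refine Submodule.sum_mem _ fun i _ => Submodule.sum_mem _ fun j _ => Submodule.smul_mem _ _ ?_
  rw [mono_eq_even_mul]
  exact Submodule.mul_mem_mul ⟨_, rfl⟩ (Submodule.mul_mem_mul ⟨_, rfl⟩ ⟨_, rfl⟩)

theorem dualActElt_mem (σ : Module.Dual K θ →ₗ[K] Module.Dual K g →ₗ[K] Module.Dual K g) :
    (dualActElt σ : BigAlg K θ g) ∈ component K θ g 1 1 1 0 := by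
  rw [component_one_one_one_zero]
  refine Submodule.sum_mem _ fun i _ => Submodule.sum_mem _ fun j _ => Submodule.smul_mem _ _ ?_
  exact Submodule.mul_mem_mul (Submodule.mul_mem_mul ⟨_, rfl⟩ ⟨_, rfl⟩) ⟨_, rfl⟩

omit [FiniteDimensional K g] in
theorem mapElt_mem (φ : θ →ₗ[K] g) : (mapElt φ : BigAlg K θ g) ∈ component K θ g 1 0 0 1 := by
  rw [component_one_zero_zero_one]
  exact Submodule.sum_mem _ fun j _ => Submodule.mul_mem_mul ⟨_, rfl⟩ ⟨_, rfl⟩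

omit [FiniteDimensional K θ] in
theorem sum_smul_odd_baseDual (ξ : Module.Dual K g) :
    ∑ i, ξ (Module.finBasis K g i) •
      (odd K (0, (Module.finBasis K g).coord i) : BigAlg K θ g) = odd K (0, ξ) := by
  conv_rhs => rw [← sum_apply_smul_coord (Module.finBasis K g) ξ]
  have h : ∀ ξ : Module.Dual K g, (odd K (0, ξ) : BigAlg K θ g) = ofBaseDual K θ g ξ :=
    fun _ => rfl
  simp only [h, map_sum, map_smul]

omit [FiniteDimensional K g] in
theorem sum_smul_even_topDual (κ : Module.Dual K θ) :
    ∑ i, κ (Module.finBasis K θ i) •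
      (even K (0, (Module.finBasis K θ).coord i) : BigAlg K θ g) = even K (0, κ) := by
  conv_rhs => rw [← sum_apply_smul_coord (Module.finBasis K θ) κ]
  have h : ∀ κ : Module.Dual K θ, (even K (0, κ) : BigAlg K θ g) = ofTopDual K θ g κ :=
    fun _ => rfl
  simp only [h, map_sum, map_smul]

omit [FiniteDimensional K θ] in
theorem sum_smul_even_base (x : g) :
    ∑ i, (Module.finBasis K g).coord i x •
      (even K (Module.finBasis K g i, 0) : BigAlg K θ g) = even K (x, 0) := by
  conv_rhs => rw [← (Module.finBasis K g).sum_repr x]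
  have h : ∀ x : g, (even K (x, 0) : BigAlg K θ g) = ofBase K θ g x := fun _ => rfl
  simp only [h, map_sum, map_smul]
  rfl

omit [FiniteDimensional K g] in
theorem sum_smul_odd_top (u : θ) :
    ∑ i, (Module.finBasis K θ).coord i u •
      (odd K (Module.finBasis K θ i, 0) : BigAlg K θ g) = odd K (u, 0) := by
  conv_rhs => rw [← (Module.finBasis K θ).sum_repr u]
  have h : ∀ u : θ, (odd K (u, 0) : BigAlg K θ g) = ofTop K θ g u := fun _ => rfl
  simp only [h, map_sum, map_smul]
  rfl

omit [FiniteDimensional K θ] [FiniteDimensional K g] in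
theorem mono_smul_left (c : K) (η η' : θ × Module.Dual K g) (v : g × Module.Dual K θ) :
    mono (c • η) η' v = c • mono η η' v := by
  simp only [mono, map_smul, smul_mul_assoc]

omit [FiniteDimensional K θ] [FiniteDimensional K g] in
theorem mono_smul_middle (c : K) (η η' : θ × Module.Dual K g) (v : g × Module.Dual K θ) :
    mono η (c • η') v = c • mono η η' v := by
  simp only [mono, map_smul, smul_mul_assoc, mul_smul_comm]

omit [FiniteDimensional K θ] [FiniteDimensional K g] in
theorem mono_smul_right (c : K) (η η' : θ × Module.Dual K g) (v : g × Module.Dual K θ) :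
    mono η η' (c • v) = c • mono η η' v := by
  simp only [mono, map_smul, mul_smul_comm]

omit [FiniteDimensional K θ] [FiniteDimensional K g] in
theorem sum_sum_smul_mono {ι ι' : Type*} [Fintype ι] [Fintype ι'] (a : ι → K) (b : ι' → K)
    (η : ι → θ × Module.Dual K g) (η' : ι' → θ × Module.Dual K g) (v : g × Module.Dual K θ) :
    ∑ i, ∑ j, (a i * b j) • mono (η i) (η' j) v =
      (∑ i, a i • odd K (η i)) * (∑ j, b j • odd K (η' j)) * even K v := by
  simp only [mono, Finset.sum_mul, Finset.mul_sum, Finset.smul_sum, smul_mul_assoc, mul_smul_comm,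
    smul_smul]
  rw [Finset.sum_comm]
  exact Finset.sum_congr rfl fun i _ => Finset.sum_congr rfl fun j _ => by rw [mul_comm]

omit [FiniteDimensional K θ] [FiniteDimensional K g] in
/-- Antisymmetrizing the coefficients of a monomial in two odd generators gives back the monomial,
since odd generators anticommute. -/
theorem sum_sum_smul_mono_alternating [CharZero K] {ι : Type*} [Fintype ι] (a b : ι → K)
    (η : ι → θ × Module.Dual K g) (v : g × Module.Dual K θ) {ζ ζ' : θ × Module.Dual K g}
    (ha : ∑ i, a i • (odd K (η i) : BigAlg K θ g) = odd K ζ)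
    (hb : ∑ i, b i • (odd K (η i) : BigAlg K θ g) = odd K ζ') :
    ∑ i, ∑ j, (-2⁻¹ : K) • mono (η i) (η j) ((b i * a j + -1 * (a i * b j)) • v) =
      mono ζ ζ' v := by
  have h : ∀ i j, (-2⁻¹ : K) • mono (η i) (η j) ((b i * a j + -1 * (a i * b j)) • v) =
      (-2⁻¹ : K) • (b i * a j) • mono (η i) (η j) v +
        (2⁻¹ : K) • (a i * b j) • mono (η i) (η j) v := by
    intro i j
    rw [mono_smul_right, smul_smul, smul_smul, smul_smul, ← add_smul]
    congr 1
    ring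
  have key {X : Type _} [AddCommGroup X] [Module K X] (x : X) :
      (-2⁻¹ : K) • -x + (2⁻¹ : K) • x = x := by
    rw [smul_neg, neg_smul, neg_neg, ← add_smul, ← two_mul, mul_inv_cancel₀ two_ne_zero, one_smul]
  simp only [h, Finset.sum_add_distrib, ← Finset.smul_sum, sum_sum_smul_mono, ha, hb]
  rw [odd_mul_odd ζ' ζ, neg_mul_eq]
  exact key _

omit [FiniteDimensional K θ] in
theorem exists_eq_baseElt [CharZero K] {F : BigAlg K θ g} (hF : F ∈ component K θ g 1 2 0 0) :
    ∃ β : g →ₗ[K] g →ₗ[K] g, (∀ x, β x x = 0) ∧ F = baseElt β := by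
  rw [component_one_two_zero_zero] at hF
  have hadd : ∀ F G : BigAlg K θ g,
      (∃ β : g →ₗ[K] g →ₗ[K] g, (∀ x, β x x = 0) ∧ F = baseElt β) →
      (∃ β : g →ₗ[K] g →ₗ[K] g, (∀ x, β x x = 0) ∧ G = baseElt β) →
      ∃ β : g →ₗ[K] g →ₗ[K] g, (∀ x, β x x = 0) ∧ F + G = baseElt β := by
    rintro _ _ ⟨β, hβ, rfl⟩ ⟨β', hβ', rfl⟩
    refine ⟨β + β', fun x => by simp [hβ, hβ'], ?_⟩
    have h : ∀ x : g, (even K (x, 0) : BigAlg K θ g) = ofBase K θ g x := fun _ => rfl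
    simp only [baseElt, mono, h, LinearMap.add_apply, map_add, mul_add, smul_add,
      Finset.sum_add_distrib]
  induction hF using Submodule.mul_induction_on' with
  | add F _ G _ hF hG => exact hadd F G hF hG
  | mem_mul_mem m hm n hn =>
    obtain ⟨x, rfl⟩ := hn
    induction hm using Submodule.mul_induction_on' with
    | add F _ G _ hF hG => rw [add_mul]; exact hadd _ _ hF hG
    | mem_mul_mem m hm n hn =>
      obtain ⟨ξ, rfl⟩ := hm
      obtain ⟨ξ', rfl⟩ := hn
      refine ⟨ξ'.smulRight (LinearMap.smulRight ξ x) + (-1 : K) • ξ.smulRight (ξ'.smulRight x),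
        ?_, ?_⟩
      · intro y
        simp only [LinearMap.add_apply, LinearMap.smul_apply, LinearMap.smulRight_apply, smul_smul,
          ← add_smul]
        rw [show ξ' y * ξ y + -1 * ξ y * ξ' y = 0 by ring, zero_smul]
      · have h : ∀ a b : g, ((ξ'.smulRight (LinearMap.smulRight ξ x) +
            (-1 : K) • ξ.smulRight (ξ'.smulRight x)) a b, (0 : Module.Dual K θ)) =
            (ξ' a * ξ b + -1 * (ξ a * ξ' b)) • (x, (0 : Module.Dual K θ)) := by
          intro a b
          simp [smul_smul, add_smul]
        simp only [baseElt, h]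
        exact (sum_sum_smul_mono_alternating _ _ _ _ (sum_smul_odd_baseDual ξ)
          (sum_smul_odd_baseDual ξ')).symm

theorem exists_eq_actElt {F : BigAlg K θ g} (hF : F ∈ component K θ g 0 1 1 1) :
    ∃ ρ : g →ₗ[K] θ →ₗ[K] θ, F = actElt ρ := by
  rw [component_zero_one_one_one] at hF
  have hadd : ∀ F G : BigAlg K θ g, (∃ ρ : g →ₗ[K] θ →ₗ[K] θ, F = actElt ρ) →
      (∃ ρ : g →ₗ[K] θ →ₗ[K] θ, G = actElt ρ) → ∃ ρ : g →ₗ[K] θ →ₗ[K] θ, F + G = actElt ρ := by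
    rintro _ _ ⟨β, rfl⟩ ⟨β', rfl⟩
    refine ⟨β + β', ?_⟩
    have h : ∀ x : θ, (odd K (x, 0) : BigAlg K θ g) = ofTop K θ g x := fun _ => rfl
    simp only [actElt, mono, h, LinearMap.add_apply, map_add, mul_add, add_mul,
      Finset.sum_add_distrib]
  induction hF using Submodule.mul_induction_on' with
  | add F _ G _ hF hG => exact hadd F G hF hG
  | mem_mul_mem m hm n hn =>
    obtain ⟨u, rfl⟩ := hn
    induction hm using Submodule.mul_induction_on' with
    | add F _ G _ hF hG => rw [add_mul]; exact hadd _ _ hF hG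
    | mem_mul_mem m hm n hn =>
      obtain ⟨ξ, rfl⟩ := hm
      obtain ⟨κ, rfl⟩ := hn
      refine ⟨ξ.smulRight (LinearMap.smulRight κ u), ?_⟩
      have h : ∀ (a : g) (b : θ),
          (LinearMap.smulRight ξ (LinearMap.smulRight κ u) a b, (0 : Module.Dual K g)) =
            (ξ a * κ b) • (u, (0 : Module.Dual K g)) := by
        intro a b
        simp [smul_smul]
      simp only [actElt, h, mono_smul_middle]
      simp only [mono_eq_mul_mul]
      change odd K (0, ξ) * even K (0, κ) * odd K (u, 0) = _
      rw [← sum_smul_odd_baseDual ξ, ← sum_smul_even_topDual κ]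
      simp only [Finset.sum_mul, Finset.mul_sum, Finset.smul_sum, smul_mul_assoc, mul_smul_comm,
        smul_smul]
      rw [Finset.sum_comm]
      exact Finset.sum_congr rfl fun i _ => Finset.sum_congr rfl fun j _ => by rw [mul_comm]

omit [FiniteDimensional K g] in
theorem exists_eq_dualBaseElt [CharZero K] {F : BigAlg K θ g}
    (hF : F ∈ component K θ g 0 0 2 1) :
    ∃ γ : Module.Dual K θ →ₗ[K] Module.Dual K θ →ₗ[K] Module.Dual K θ,
      (∀ κ, γ κ κ = 0) ∧ F = dualBaseElt γ := by
  rw [component_zero_zero_two_one] at hF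
  have hadd : ∀ F G : BigAlg K θ g,
      (∃ γ : Module.Dual K θ →ₗ[K] Module.Dual K θ →ₗ[K] Module.Dual K θ,
        (∀ κ, γ κ κ = 0) ∧ F = dualBaseElt γ) →
      (∃ γ : Module.Dual K θ →ₗ[K] Module.Dual K θ →ₗ[K] Module.Dual K θ,
        (∀ κ, γ κ κ = 0) ∧ G = dualBaseElt γ) →
      ∃ γ : Module.Dual K θ →ₗ[K] Module.Dual K θ →ₗ[K] Module.Dual K θ,
        (∀ κ, γ κ κ = 0) ∧ F + G = dualBaseElt γ := by
    rintro _ _ ⟨β, hβ, rfl⟩ ⟨β', hβ', rfl⟩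
    refine ⟨β + β', fun x => by simp [hβ, hβ'], ?_⟩
    have h : ∀ x : Module.Dual K θ, (even K (0, x) : BigAlg K θ g) = ofTopDual K θ g x :=
      fun _ => rfl
    simp only [dualBaseElt, mono, h, LinearMap.add_apply, map_add, mul_add, smul_add,
      Finset.sum_add_distrib]
  induction hF using Submodule.mul_induction_on' with
  | add F _ G _ hF hG => exact hadd F G hF hG
  | mem_mul_mem m hm n hn =>
    obtain ⟨κ, rfl⟩ := hm
    induction hn using Submodule.mul_induction_on' with
    | add F _ G _ hF hG => rw [mul_add]; exact hadd _ _ hF hG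
    | mem_mul_mem m hm n hn =>
      obtain ⟨u, rfl⟩ := hm
      obtain ⟨v, rfl⟩ := hn
      let eu := Module.Dual.eval K θ u
      let ev := Module.Dual.eval K θ v
      refine ⟨ev.smulRight (eu.smulRight κ) + (-1 : K) • eu.smulRight (ev.smulRight κ), ?_, ?_⟩
      · intro y
        simp only [LinearMap.add_apply, LinearMap.smul_apply, LinearMap.smulRight_apply, smul_smul,
          ← add_smul]
        rw [show ev y * eu y + -1 * eu y * ev y = 0 by ring, zero_smul]
      · have h : ∀ a b : Module.Dual K θ, ((0 : g), (ev.smulRight (eu.smulRight κ) +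
            (-1 : K) • eu.smulRight (ev.smulRight κ)) a b) =
            (a v * b u + -1 * (a u * b v)) • ((0 : g), κ) := by
          intro a b
          simp [eu, ev, smul_smul, add_smul]
        simp only [dualBaseElt, h]
        refine Eq.trans ?_ (sum_sum_smul_mono_alternating _ _ _ _ (sum_smul_odd_top u)
          (sum_smul_odd_top v)).symm
        rw [mono_eq_even_mul]
        rfl

theorem exists_eq_dualActElt {F : BigAlg K θ g} (hF : F ∈ component K θ g 1 1 1 0) :
    ∃ σ : Module.Dual K θ →ₗ[K] Module.Dual K g →ₗ[K] Module.Dual K g, F = dualActElt σ := by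
  rw [component_one_one_one_zero] at hF
  have hadd : ∀ F G : BigAlg K θ g,
      (∃ σ : Module.Dual K θ →ₗ[K] Module.Dual K g →ₗ[K] Module.Dual K g, F = dualActElt σ) →
      (∃ σ : Module.Dual K θ →ₗ[K] Module.Dual K g →ₗ[K] Module.Dual K g, G = dualActElt σ) →
      ∃ σ : Module.Dual K θ →ₗ[K] Module.Dual K g →ₗ[K] Module.Dual K g,
        F + G = dualActElt σ := by
    rintro _ _ ⟨β, rfl⟩ ⟨β', rfl⟩
    refine ⟨β + β', ?_⟩
    have h : ∀ x : Module.Dual K g, (odd K (0, x) : BigAlg K θ g) = ofBaseDual K θ g x :=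
      fun _ => rfl
    simp only [dualActElt, mono, h, LinearMap.add_apply, map_add, smul_add, add_mul,
      Finset.sum_add_distrib]
  induction hF using Submodule.mul_induction_on' with
  | add F _ G _ hF hG => exact hadd F G hF hG
  | mem_mul_mem m hm n hn =>
    obtain ⟨x, rfl⟩ := hn
    induction hm using Submodule.mul_induction_on' with
    | add F _ G _ hF hG => rw [add_mul]; exact hadd _ _ hF hG
    | mem_mul_mem m hm n hn =>
      obtain ⟨ξ, rfl⟩ := hm
      obtain ⟨u, rfl⟩ := hn
      refine ⟨(-1 : K) • (Module.Dual.eval K θ u).smulRight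
        ((Module.Dual.eval K g x).smulRight ξ), ?_⟩
      have h : ∀ (a : Module.Dual K θ) (b : Module.Dual K g),
          ((0 : θ), ((-1 : K) • (Module.Dual.eval K θ u).smulRight
            ((Module.Dual.eval K g x).smulRight ξ)) a b) =
            (-1 * (a u * b x)) • ((0 : θ), ξ) := by
        intro a b
        refine Prod.ext (by simp) ?_
        simp only [LinearMap.smul_apply, LinearMap.smulRight_apply, Prod.smul_snd, smul_smul,
          Module.Dual.eval_apply, mul_assoc]
      simp only [dualActElt, h, mono_smul_left]
      change odd K (0, ξ) * odd K (u, 0) * even K (x, 0) = _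
      rw [← sum_smul_odd_top u, ← sum_smul_even_base x]
      simp only [Finset.sum_mul, Finset.mul_sum, Finset.smul_sum, smul_mul_assoc, mul_smul_comm,
        smul_smul, mono]
      rw [Finset.sum_comm]
      exact Finset.sum_congr rfl fun i _ => Finset.sum_congr rfl fun j _ => by
        congr 1; ring

omit [FiniteDimensional K g] in
theorem exists_eq_mapElt {F : BigAlg K θ g} (hF : F ∈ component K θ g 1 0 0 1) :
    ∃ φ : θ →ₗ[K] g, F = mapElt φ := by
  rw [component_one_zero_zero_one] at hF
  induction hF using Submodule.mul_induction_on' with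
  | add F _ G _ hF hG =>
    obtain ⟨φ, rfl⟩ := hF
    obtain ⟨φ', rfl⟩ := hG
    refine ⟨φ + φ', ?_⟩
    have h : ∀ x : g, (even K (x, 0) : BigAlg K θ g) = ofBase K θ g x := fun _ => rfl
    simp only [mapElt, h, LinearMap.add_apply, map_add, mul_add, Finset.sum_add_distrib]
  | mem_mul_mem m hm n hn =>
    obtain ⟨κ, rfl⟩ := hm
    obtain ⟨x, rfl⟩ := hn
    refine ⟨κ.smulRight x, ?_⟩
    have h : ∀ a : θ, (LinearMap.smulRight κ x a, (0 : Module.Dual K θ)) =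
        κ a • (x, (0 : Module.Dual K θ)) := by
      intro a
      simp
    change even K (0, κ) * even K (x, 0) = _
    rw [mapElt, ← sum_smul_even_topDual κ, Finset.sum_mul]
    simp only [h, map_smul, smul_mul_assoc, mul_smul_comm]

end Components

end BigAlg
end

noncomputable section

/-! ### The cocycle condition of a Lie bialgebra in dual form -/

section Cocycle

variable {K L L' : Type*} [Field K] [AddCommGroup L] [Module K L]
  [AddCommGroup L'] [Module K L']

theorem tensor_ext_dualDistrib [FiniteDimensional K L] {s t : L ⊗[K] L}
    (h : ∀ α β : Module.Dual K L, TensorProduct.dualDistrib K L L (α ⊗ₜ β) s =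
      TensorProduct.dualDistrib K L L (α ⊗ₜ β) t) : s = t := by
  let b := Module.finBasis K L
  have hb : ∀ (t : L ⊗[K] L) i j, (b.tensorProduct b).repr t (i, j) =
      TensorProduct.dualDistrib K L L (b.coord i ⊗ₜ b.coord j) t := by
    intro t i j
    induction t using TensorProduct.induction_on with
    | zero => simp
    | tmul x y => simp [Module.Basis.tensorProduct_repr_tmul_apply, mul_comm]
    | add x y hx hy => rw [map_add, map_add, Finsupp.add_apply, hx, hy]
  apply (b.tensorProduct b).repr.injective
  ext ⟨i, j⟩
  rw [hb, hb, h]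

theorem dualDistrib_adTensor (A : LieStr K L) (x : L) (α β : Module.Dual K L) (t : L ⊗[K] L) :
    TensorProduct.dualDistrib K L L (α ⊗ₜ β) (A.adTensor x t) =
      TensorProduct.dualDistrib K L L ((α ∘ₗ A.bracket x) ⊗ₜ β) t +
        TensorProduct.dualDistrib K L L (α ⊗ₜ (β ∘ₗ A.bracket x)) t := by
  induction t using TensorProduct.induction_on with
  | zero => simp
  | tmul x y => simp [LieStr.adTensor]
  | add x y hx hy => rw [map_add, map_add, hx, hy, map_add, map_add]; ring

/-- In finite dimension, the cocycle condition of a Lie bialgebra can be tested on functionals: the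
bracket of the dual Lie algebra determines the cobracket. -/
theorem isLieBialgebra_iff [FiniteDimensional K L] (A : LieStr K L) (A' : LieStr K L')
    (e : L' ≃ₗ[K] Module.Dual K L) :
    IsLieBialgebra A A' e ↔ ∀ (x y : L) (α β : L'),
      e (A'.bracket α β) (A.bracket x y) =
        (e (A'.bracket (e.symm (e α ∘ₗ A.bracket x)) β) y +
          e (A'.bracket α (e.symm (e β ∘ₗ A.bracket x))) y) -
        (e (A'.bracket (e.symm (e α ∘ₗ A.bracket y)) β) x +
          e (A'.bracket α (e.symm (e β ∘ₗ A.bracket y))) x) := by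
  have hpair : ∀ (cobr : L →ₗ[K] L ⊗[K] L)
      (_ : ∀ (x : L) (α β : L'), TensorProduct.dualDistrib K L L (e α ⊗ₜ e β) (cobr x) =
        e (A'.bracket α β) x) (x y : L) (α β : L'),
      TensorProduct.dualDistrib K L L (e α ⊗ₜ e β) (A.adTensor x (cobr y)) =
        e (A'.bracket (e.symm (e α ∘ₗ A.bracket x)) β) y +
          e (A'.bracket α (e.symm (e β ∘ₗ A.bracket x))) y := by
    intro cobr h x y α β
    rw [dualDistrib_adTensor, ← h, ← h, e.apply_symm_apply, e.apply_symm_apply]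
  constructor
  · rintro ⟨cobr, h, hc⟩ x y α β
    rw [← h, hc, map_sub, hpair cobr h, hpair cobr h]
  · intro hc
    let b := Module.finBasis K L
    let c := b.dualBasis.map e.symm
    have h : ∀ (x : L) (α β : L'), TensorProduct.dualDistrib K L L (e α ⊗ₜ e β)
        ((∑ i, ∑ j, (e (A'.bracket (c i) (c j))).smulRight (b i ⊗ₜ[K] b j)) x) =
          e (A'.bracket α β) x := by
      intro x α β
      have h1 := BigAlg.sum_coord_smul_bilin c c
        (A'.bracket.compr₂ (Module.Dual.eval K L x ∘ₗ e.toLinearMap)) α β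
      simp only [LinearMap.compr₂_apply, LinearMap.comp_apply, LinearEquiv.coe_coe,
        Module.Dual.eval_apply] at h1
      rw [← h1]
      simp only [LinearMap.sum_apply, map_sum, LinearMap.smulRight_apply, map_smul,
        TensorProduct.dualDistrib_apply]
      refine Finset.sum_congr rfl fun i _ => Finset.sum_congr rfl fun j _ => ?_
      have h2 : ∀ i α, c.coord i α = e α (b i) := by
        intro i α
        simp [c]
      rw [h2, h2, smul_eq_mul, smul_eq_mul, mul_comm]
    refine ⟨_, h, fun x y => ?_⟩
    apply tensor_ext_dualDistrib
    intro α β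
    obtain ⟨α, rfl⟩ := e.surjective α
    obtain ⟨β, rfl⟩ := e.surjective β
    rw [h, hc, map_sub, hpair _ h, hpair _ h]

end Cocycle

end

noncomputable section

/-! ### The equation `{ε, ε} = 0` in terms of structure maps -/

section Compatible

variable {K θ g : Type*} [Field K] [AddCommGroup θ] [Module K θ] [AddCommGroup g] [Module K g]

/-- The identities between a bracket `β` on `𝔤`, a map `ρ : 𝔤 × θ → θ`, a bracket `γ` on `θ*`, a map
`σ : θ* × 𝔤* → 𝔤*` and `φ : θ → 𝔤` that define a Lie bialgebra crossed module: `𝔤` and `θ*` are Lie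
algebras that act on `θ` and `𝔤*`, they form a matched pair for the dual actions, and `φ` and
`-φ*` are equivariant with antisymmetric Peiffer brackets. -/
structure IsCompatible (β : g →ₗ[K] g →ₗ[K] g) (ρ : g →ₗ[K] θ →ₗ[K] θ)
    (γ : Module.Dual K θ →ₗ[K] Module.Dual K θ →ₗ[K] Module.Dual K θ)
    (σ : Module.Dual K θ →ₗ[K] Module.Dual K g →ₗ[K] Module.Dual K g) (φ : θ →ₗ[K] g) :
    Prop where
  base_self : ∀ x, β x x = 0
  dual_self : ∀ κ, γ κ κ = 0
  base_jacobi : ∀ x y z, β (β y z) x - β (β x z) y + β (β x y) z = 0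
  dual_jacobi : ∀ κ l m, γ (γ l m) κ - γ (γ κ m) l + γ (γ κ l) m = 0
  act : ∀ x y u, ρ (β x y) u = ρ x (ρ y u) - ρ y (ρ x u)
  dual_act : ∀ κ l ξ, σ (γ κ l) ξ = σ κ (σ l ξ) - σ l (σ κ ξ)
  matched_base : ∀ x y κ ξ, σ κ ξ (β x y) = σ κ (ξ ∘ₗ β x) y + σ (κ ∘ₗ ρ x) ξ y -
    (σ κ (ξ ∘ₗ β y) x + σ (κ ∘ₗ ρ y) ξ x)
  matched_dual : ∀ x u κ l, γ κ l (ρ x u) = γ (κ ∘ₗ ρ x) l u + γ κ (l ∘ₗ ρ x) u -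
    (σ l (κ ∘ₗ ρ.flip u) x - σ κ (l ∘ₗ ρ.flip u) x)
  equivariant : ∀ x u, φ (ρ x u) = β x (φ u)
  dual_equivariant : ∀ κ ξ, (σ κ ξ) ∘ₗ φ = γ κ (ξ ∘ₗ φ)
  peiffer : ∀ u v, ρ (φ u) v = -ρ (φ v) u
  dual_peiffer : ∀ ξ η, σ (ξ ∘ₗ φ) η = -σ (η ∘ₗ φ) ξ

theorem eq_of_forall_dual_apply_eq {V : Type*} [AddCommGroup V] [Module K V] {x y : V}
    (h : ∀ α : Module.Dual K V, α x = α y) : x = y := by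
  rw [← sub_eq_zero, ← Module.forall_dual_apply_eq_zero_iff K]
  intro α
  rw [map_sub, h, sub_self]

/-- The Jacobi identity of the total bracket on `𝔤 × θ*` and the invariance of `φ`, viewed as a
symmetric tensor, amount to the identities of a Lie bialgebra crossed module. -/
theorem isCompatible_iff {β : g →ₗ[K] g →ₗ[K] g} {ρ : g →ₗ[K] θ →ₗ[K] θ}
    {γ : Module.Dual K θ →ₗ[K] Module.Dual K θ →ₗ[K] Module.Dual K θ}
    {σ : Module.Dual K θ →ₗ[K] Module.Dual K g →ₗ[K] Module.Dual K g} {φ : θ →ₗ[K] g}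
    (hβ : ∀ x, β x x = 0) (hγ : ∀ κ, γ κ κ = 0)
    {B : (g × Module.Dual K θ) →ₗ[K] (g × Module.Dual K θ) →ₗ[K] (g × Module.Dual K θ)}
    {R : (θ × Module.Dual K g) →ₗ[K] (g × Module.Dual K θ)}
    (hB : ∀ w w' η, BigAlg.pairing K θ g (B w w') η =
      η.2 (β w.1 w'.1) + (w.2 (ρ w'.1 η.1) - w'.2 (ρ w.1 η.1)) + γ w.2 w'.2 η.1 +
        (σ w'.2 η.2 w.1 - σ w.2 η.2 w'.1))
    (hR : ∀ η, R η = (φ η.1, η.2 ∘ₗ φ)) :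
    ((∀ a b c, B (B b c) a - B (B a c) b + B (B a b) c = 0) ∧
      ∀ w η η', BigAlg.pairing K θ g (B (R η) w) η' + BigAlg.pairing K θ g (B (R η') w) η = 0) ↔
      IsCompatible β ρ γ σ φ := by
  have h1 : ∀ w w' (ξ : Module.Dual K g),
      ξ (B w w').1 = ξ (β w.1 w'.1) + σ w'.2 ξ w.1 - σ w.2 ξ w'.1 := by
    intro w w' ξ
    have := hB w w' (0, ξ)
    simp only [BigAlg.pairing_apply, map_zero, sub_zero, add_zero] at this
    rw [this]; ring
  have h2 : ∀ w w', (B w w').2 = γ w.2 w'.2 - w'.2 ∘ₗ ρ w.1 + w.2 ∘ₗ ρ w'.1 := by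
    intro w w'
    ext u
    have := hB w w' (u, 0)
    simp only [BigAlg.pairing_apply, map_zero, LinearMap.zero_apply, sub_zero, add_zero,
      zero_add] at this
    simp only [LinearMap.add_apply, LinearMap.sub_apply, LinearMap.comp_apply]
    rw [this]; ring
  have hflip : ∀ (ξ : Module.Dual K g) x y, ξ (β x y) = -(ξ ∘ₗ β y) x := by
    intro ξ x y
    rw [skew_of_self hβ, map_neg, LinearMap.comp_apply]
  have hρ : ∀ (κ : Module.Dual K θ) x u, κ (ρ x u) = (κ ∘ₗ ρ.flip u) x := fun _ _ _ => rfl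
  -- the components in `𝔤` and `θ*` of a summand of the Jacobiator, tested by functionals
  have J1 : ∀ a b c (ξ : Module.Dual K g), ξ (B (B a b) c).1 =
      -((ξ ∘ₗ β c.1) (β a.1 b.1) + σ b.2 (ξ ∘ₗ β c.1) a.1 - σ a.2 (ξ ∘ₗ β c.1) b.1) +
        (σ c.2 ξ (β a.1 b.1) + σ b.2 (σ c.2 ξ) a.1 - σ a.2 (σ c.2 ξ) b.1) -
        (σ (γ a.2 b.2) ξ c.1 - σ (b.2 ∘ₗ ρ a.1) ξ c.1 + σ (a.2 ∘ₗ ρ b.1) ξ c.1) := by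
    intro a b c ξ
    rw [h1 (B a b) c, hflip, h1, h1, h2]
    simp only [map_add, map_sub, LinearMap.add_apply, LinearMap.sub_apply]
  have J2 : ∀ a b c u, (B (B a b) c).2 u =
      (γ (γ a.2 b.2) c.2 u - γ (b.2 ∘ₗ ρ a.1) c.2 u + γ (a.2 ∘ₗ ρ b.1) c.2 u) -
      (c.2 (ρ (β a.1 b.1) u) + σ b.2 (c.2 ∘ₗ ρ.flip u) a.1 - σ a.2 (c.2 ∘ₗ ρ.flip u) b.1) +
      (γ a.2 b.2 (ρ c.1 u) - b.2 (ρ a.1 (ρ c.1 u)) + a.2 (ρ b.1 (ρ c.1 u))) := by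
    intro a b c u
    rw [h2 (B a b) c]
    simp only [LinearMap.add_apply, LinearMap.sub_apply, LinearMap.comp_apply]
    rw [hρ c.2, h1, h2]
    simp only [map_add, map_sub, LinearMap.add_apply, LinearMap.sub_apply, LinearMap.comp_apply,
      LinearMap.flip_apply]
  have two : ∀ (a b c : g × Module.Dual K θ), a - b + c = 0 ↔
      (∀ ξ : Module.Dual K g, ξ a.1 - ξ b.1 + ξ c.1 = 0) ∧
        ∀ u, a.2 u - b.2 u + c.2 u = 0 := by
    intro a b c
    rw [Prod.ext_iff, Prod.fst_zero, Prod.snd_zero, ← Module.forall_dual_apply_eq_zero_iff K,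
      LinearMap.ext_iff]
    simp only [Prod.fst_add, Prod.fst_sub, Prod.snd_add, Prod.snd_sub, map_add, map_sub,
      LinearMap.add_apply, LinearMap.sub_apply, LinearMap.zero_apply]
  constructor
  -- each identity is the given one evaluated at arguments in the summands `𝔤`, `θ*`, `θ`, `𝔤*`
  · rintro ⟨hJ, hI⟩
    have hJ1 := fun a b c => ((two _ _ _).1 (hJ a b c)).1
    have hJ2 := fun a b c => ((two _ _ _).1 (hJ a b c)).2
    simp only [J1] at hJ1
    simp only [J2] at hJ2
    simp only [hR, hB] at hI
    constructor
    · exact hβ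
    · exact hγ
    · intro x y z
      refine eq_of_forall_dual_apply_eq (K := K) fun ξ => ?_
      have := hJ1 (x, 0) (y, 0) (z, 0) ξ
      simp only [map_zero, LinearMap.zero_apply, LinearMap.zero_comp] at this
      rw [map_add, map_sub, map_zero, hflip ξ (β y z) x, hflip ξ (β x z) y, hflip ξ (β x y) z]
      linear_combination this
    · intro κ l m
      refine LinearMap.ext fun u => ?_
      have := hJ2 (0, κ) (0, l) (0, m) u
      simp only [map_zero, LinearMap.zero_apply, LinearMap.comp_zero] at this
      simp only [LinearMap.add_apply, LinearMap.sub_apply, LinearMap.zero_apply]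
      linear_combination this
    · intro x y u
      refine eq_of_forall_dual_apply_eq (K := K) fun κ => ?_
      have := hJ2 (x, 0) (y, 0) (0, κ) u
      simp only [map_zero, LinearMap.zero_apply, LinearMap.comp_zero, LinearMap.zero_comp] at this
      rw [map_sub]
      linear_combination -this
    · intro κ l ξ
      refine LinearMap.ext fun x => ?_
      have := hJ1 (x, 0) (0, κ) (0, l) ξ
      simp only [map_zero, LinearMap.zero_apply, LinearMap.comp_zero] at this
      rw [LinearMap.sub_apply]
      linear_combination -this
    · intro x y κ ξ
      have := hJ1 (x, 0) (y, 0) (0, κ) ξ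
      simp only [map_zero, LinearMap.zero_apply, LinearMap.comp_zero, LinearMap.zero_comp] at this
      linear_combination this
    · intro x u κ l
      have := hJ2 (x, 0) (0, κ) (0, l) u
      simp only [map_zero, LinearMap.zero_apply, LinearMap.comp_zero, LinearMap.zero_comp] at this
      rw [skew_of_self hγ κ (l ∘ₗ ρ x), LinearMap.neg_apply]
      linear_combination this
    · intro x u
      refine eq_of_forall_dual_apply_eq (K := K) fun ξ => ?_
      have := hI (x, 0) (u, 0) (0, ξ)
      simp only [map_zero, LinearMap.zero_apply, LinearMap.zero_comp] at this
      rw [skew_of_self hβ x, map_neg]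
      linear_combination this
    · intro κ ξ
      refine LinearMap.ext fun u => ?_
      have := hI (0, κ) (u, 0) (0, ξ)
      simp only [map_zero, LinearMap.zero_apply, LinearMap.zero_comp] at this
      rw [skew_of_self hγ κ, LinearMap.neg_apply, LinearMap.comp_apply]
      linear_combination this
    · intro u v
      refine eq_of_forall_dual_apply_eq (K := K) fun κ => ?_
      have := hI (0, κ) (u, 0) (v, 0)
      simp only [map_zero, LinearMap.zero_apply, LinearMap.zero_comp] at this
      rw [map_neg]
      linear_combination -this
    · intro ξ η
      refine LinearMap.ext fun x => ?_
      have := hI (x, 0) (0, ξ) (0, η)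
      simp only [map_zero, LinearMap.zero_apply] at this
      rw [LinearMap.neg_apply]
      linear_combination -this
  · intro h
    refine ⟨fun a b c => (two _ _ _).2 ⟨fun ξ => ?_, fun u => ?_⟩, fun w η η' => ?_⟩
    · have hj := congrArg ξ (h.base_jacobi a.1 b.1 c.1)
      rw [map_add, map_sub, map_zero, hflip ξ (β b.1 c.1) a.1, hflip ξ (β a.1 c.1) b.1,
        hflip ξ (β a.1 b.1) c.1] at hj
      have hd : ∀ κ l x, σ (γ κ l) ξ x = σ κ (σ l ξ) x - σ l (σ κ ξ) x := by
        intro κ l x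
        rw [h.dual_act, LinearMap.sub_apply]
      rw [J1, J1, J1]
      linear_combination hj + h.matched_base b.1 c.1 a.2 ξ - h.matched_base a.1 c.1 b.2 ξ +
        h.matched_base a.1 b.1 c.2 ξ - hd b.2 c.2 a.1 + hd a.2 c.2 b.1 - hd a.2 b.2 c.1
    · have hj := LinearMap.congr_fun (h.dual_jacobi a.2 b.2 c.2) u
      simp only [LinearMap.add_apply, LinearMap.sub_apply, LinearMap.zero_apply] at hj
      have hm := h.matched_dual
      simp only [fun (κ l : Module.Dual K θ) x => skew_of_self hγ κ (l ∘ₗ ρ x),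
        LinearMap.neg_apply] at hm
      have ha : ∀ (κ : Module.Dual K θ) x y,
          κ (ρ (β x y) u) = κ (ρ x (ρ y u)) - κ (ρ y (ρ x u)) := by
        intro κ x y
        rw [h.act, map_sub]
      rw [J2, J2, J2]
      linear_combination hj + hm a.1 u b.2 c.2 - hm b.1 u a.2 c.2 + hm c.1 u a.2 b.2 -
        ha a.2 b.1 c.1 + ha b.2 a.1 c.1 - ha c.2 a.1 b.1
    · have e1 : ∀ (ξ : Module.Dual K g) u, (ξ ∘ₗ φ) (ρ w.1 u) = -ξ (β (φ u) w.1) := by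
        intro ξ u
        rw [LinearMap.comp_apply, h.equivariant, skew_of_self hβ, map_neg]
      have e2 : ∀ (ξ : Module.Dual K g) u, σ w.2 ξ (φ u) = -γ (ξ ∘ₗ φ) w.2 u := by
        intro ξ u
        rw [← LinearMap.comp_apply, h.dual_equivariant, skew_of_self hγ, LinearMap.neg_apply]
      have e3 := congrArg w.2 (h.peiffer η.1 η'.1)
      have e4 := LinearMap.congr_fun (h.dual_peiffer η.2 η'.2) w.1
      rw [map_neg] at e3
      rw [LinearMap.neg_apply] at e4
      rw [hB, hB, hR, hR]
      linear_combination e1 η.2 η'.1 + e1 η'.2 η.1 + e2 η'.2 η.1 + e2 η.2 η'.1 - e3 - e4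

end Compatible

end

noncomputable section

/-! ### Lie bialgebra crossed modules in terms of structure maps -/

section CrossedModules

variable {K θ g : Type*} [Field K] [AddCommGroup θ] [Module K θ] [AddCommGroup g] [Module K g]

/-- A Lie algebra crossed module from a Lie algebra `𝔤`, an action on `θ` and an equivariant map
`φ : θ → 𝔤` with antisymmetric Peiffer bracket `φ(u) ▷ v`; this bracket is the one on `θ`. -/
def LieCrossedModule.ofPeiffer [CharZero K] (A : LieStr K g) (φ : θ →ₗ[K] g)
    (ρ : g →ₗ[K] θ →ₗ[K] θ)
    (act : ∀ x y u, ρ (A.bracket x y) u = ρ x (ρ y u) - ρ y (ρ x u))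
    (equiv : ∀ x u, φ (ρ x u) = A.bracket x (φ u)) (skew : ∀ u v, ρ (φ u) v = -ρ (φ v) u) :
    LieCrossedModule K θ g where
  lieTop :=
    { bracket := ρ ∘ₗ φ
      self := fun u => by
        have h := skew u u
        rw [eq_neg_iff_add_eq_zero, ← two_smul K, smul_eq_zero] at h
        exact h.resolve_left two_ne_zero
      jacobi := fun u v w => by
        simp only [LinearMap.comp_apply]
        rw [skew (ρ (φ v) w) u, skew (ρ (φ w) u) v, skew w u, map_neg, neg_neg, equiv, act]
        abel }
  lieBase := A
  φ := φ
  act := ρ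
  act_bracket := act
  act_derivation x u v := by
    simp only [LinearMap.comp_apply]
    rw [equiv, act]
    abel
  peiffer _ _ := rfl
  equivariant := equiv

variable [FiniteDimensional K θ] [FiniteDimensional K g]

omit [FiniteDimensional K θ] [FiniteDimensional K g] in
@[simp] theorem dualPairing_apply (a : Module.Dual K θ × Module.Dual K g) (b : g × θ) :
    dualPairing K θ g a b = a.2 b.1 + a.1 b.2 := by
  simp [dualPairing]

omit [FiniteDimensional K θ] [FiniteDimensional K g] in
theorem LieCrossedModule.semidirect_apply (M : LieCrossedModule K θ g) (a b : g × θ) :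
    M.semidirect.bracket a b = (M.lieBase.bracket a.1 b.1,
      M.act a.1 b.2 - M.act b.1 a.2 + M.act (M.φ a.2) b.2) := by
  rw [M.peiffer]
  rfl

omit [FiniteDimensional K θ] [FiniteDimensional K g] in
/-- The coadjoint action of the semidirect product. -/
theorem LieCrossedModule.dualPairing_symm_comp (M : LieCrossedModule K θ g)
    (a : Module.Dual K θ × Module.Dual K g) (X : g × θ) :
    (dualPairing K θ g).symm (dualPairing K θ g a ∘ₗ M.semidirect.bracket X) =
      (a.1 ∘ₗ M.act X.1 + a.1 ∘ₗ M.act (M.φ X.2),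
        a.2 ∘ₗ M.lieBase.bracket X.1 - a.1 ∘ₗ M.act.flip X.2) := by
  rw [LinearEquiv.symm_apply_eq]
  refine LinearMap.ext fun Y => ?_
  simp only [LinearMap.comp_apply, dualPairing_apply, M.semidirect_apply, LinearMap.add_apply,
    LinearMap.sub_apply, map_add, map_sub, LinearMap.flip_apply]
  ring

/-- Given the two crossed modules, the cocycle condition reduces to the two matched pair
conditions: the remaining components of the cocycle condition follow from equivariance and the
Peiffer identities. -/
theorem isLieBialgebra_semidirect_iff (M : LieCrossedModule K θ g)
    (M' : LieCrossedModule K (Module.Dual K g) (Module.Dual K θ)) (hφ : M'.φ = -M.φ.dualMap) :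
    IsLieBialgebra M.semidirect M'.semidirect (dualPairing K θ g) ↔
      (∀ x y κ ξ, M'.act κ ξ (M.lieBase.bracket x y) =
        M'.act κ (ξ ∘ₗ M.lieBase.bracket x) y + M'.act (κ ∘ₗ M.act x) ξ y -
        (M'.act κ (ξ ∘ₗ M.lieBase.bracket y) x + M'.act (κ ∘ₗ M.act y) ξ x)) ∧
      ∀ x u κ l, M'.lieBase.bracket κ l (M.act x u) =
        M'.lieBase.bracket (κ ∘ₗ M.act x) l u + M'.lieBase.bracket κ (l ∘ₗ M.act x) u -
        (M'.act l (κ ∘ₗ M.act.flip u) x - M'.act κ (l ∘ₗ M.act.flip u) x) := by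
  have hφ' : ∀ ξ, M'.φ ξ = -(ξ ∘ₗ M.φ) := by
    intro ξ
    rw [hφ]
    rfl
  rw [isLieBialgebra_iff]
  simp only [M.dualPairing_symm_comp, M'.semidirect_apply, M.semidirect_apply, dualPairing_apply,
    hφ']
  constructor
  · intro h
    constructor
    · intro x y κ ξ
      have := h (x, 0) (y, 0) (κ, 0) (0, ξ)
      simp only [map_zero, neg_zero, LinearMap.zero_comp, LinearMap.comp_zero,
        LinearMap.zero_apply, add_zero, sub_zero] at this
      linear_combination this
    · intro x u κ l
      have := h (x, 0) (0, u) (κ, 0) (l, 0)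
      simp only [map_zero, neg_zero, LinearMap.zero_comp, LinearMap.comp_zero,
        LinearMap.zero_apply, add_zero, zero_add, sub_zero, zero_sub, LinearMap.neg_apply,
        map_neg] at this
      linear_combination this
  · rintro ⟨hb, hd⟩ ⟨x, u⟩ ⟨y, v⟩ ⟨κ, ξ⟩ ⟨l, η⟩
    -- normal forms for the functionals that occur
    have n1 : ∀ (ξ : Module.Dual K g) x, (ξ ∘ₗ M.lieBase.bracket x) ∘ₗ M.φ =
        (ξ ∘ₗ M.φ) ∘ₗ M.act x := by
      intro ξ x
      refine LinearMap.ext fun u => ?_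
      simp only [LinearMap.comp_apply, M.equivariant]
    have n2 : ∀ (κ : Module.Dual K θ) u, (κ ∘ₗ M.act.flip u) ∘ₗ M.φ =
        -(κ ∘ₗ M.act (M.φ u)) := by
      intro κ u
      refine LinearMap.ext fun v => ?_
      simp only [LinearMap.comp_apply, LinearMap.flip_apply, LinearMap.neg_apply, M.peiffer]
      rw [M.lieTop.skew, map_neg]
    have n3 : ∀ ξ (κ : Module.Dual K θ) u, M'.act (ξ ∘ₗ M.φ) (κ ∘ₗ M.act.flip u) =
        M'.act (κ ∘ₗ M.act (M.φ u)) ξ := by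
      intro ξ κ u
      have h1 := M'.peiffer ξ (κ ∘ₗ M.act.flip u)
      have h2 := M'.peiffer (κ ∘ₗ M.act.flip u) ξ
      rw [M'.lieTop.skew, ← h2, hφ', hφ', n2, neg_neg, map_neg, LinearMap.neg_apply] at h1
      exact neg_injective h1
    have n4 : ∀ κ ξ u, M'.act κ ξ (M.φ u) = M'.lieBase.bracket κ (ξ ∘ₗ M.φ) u := by
      intro κ ξ u
      have h1 := LinearMap.congr_fun (M'.equivariant κ ξ) u
      rw [hφ', hφ', map_neg] at h1
      exact neg_injective h1
    have n5 := hd (M.φ u) v κ l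
    rw [n4, n4, n2, n2, map_neg, map_neg, M'.lieBase.skew l] at n5
    simp only [LinearMap.sub_comp, n1, n2, map_add, map_sub, map_neg,
      LinearMap.add_apply, LinearMap.sub_apply, LinearMap.neg_apply, n3] at n5 ⊢
    linear_combination hb x y κ η - hb x y l ξ - hb x y (ξ ∘ₗ M.φ) η + hd x v κ l -
      hd y u κ l + n5

omit [FiniteDimensional K θ] in
theorem LieStr.jacobi' (A : LieStr K θ) (x y z : θ) :
    A.bracket (A.bracket y z) x - A.bracket (A.bracket x z) y +
      A.bracket (A.bracket x y) z = 0 := by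
  rw [← A.jacobi x y z, A.skew z x, map_neg, LinearMap.neg_apply]
  abel

omit [FiniteDimensional K θ] in
theorem jacobi_of_self {β : θ →ₗ[K] θ →ₗ[K] θ} (h0 : ∀ x, β x x = 0)
    (h1 : ∀ x y z, β (β y z) x - β (β x z) y + β (β x y) z = 0) (x y z : θ) :
    β (β x y) z + β (β y z) x + β (β z x) y = 0 := by
  rw [← h1 x y z, skew_of_self h0 z x, map_neg, LinearMap.neg_apply]
  abel

theorem LieBialgebraCrossedModule.isCompatible (C : LieBialgebraCrossedModule K θ g) :
    IsCompatible C.cm.lieBase.bracket C.cm.act C.dualCm.lieBase.bracket C.dualCm.act C.cm.φ := by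
  have hφ : ∀ ξ, C.dualCm.φ ξ = -(ξ ∘ₗ C.cm.φ) := by
    intro ξ
    rw [C.dual_φ]
    rfl
  have hL := (isLieBialgebra_semidirect_iff C.cm C.dualCm C.dual_φ).1 C.isLieBialgebra
  refine ⟨C.cm.lieBase.self, C.dualCm.lieBase.self, C.cm.lieBase.jacobi', C.dualCm.lieBase.jacobi',
    C.cm.act_bracket, C.dualCm.act_bracket, hL.1, hL.2, C.cm.equivariant, ?_, ?_, ?_⟩
  · intro κ ξ
    have h1 := C.dualCm.equivariant κ ξ
    rw [hφ, hφ, map_neg] at h1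
    exact neg_injective h1
  · intro u v
    rw [C.cm.peiffer, C.cm.peiffer, C.cm.lieTop.skew]
  · intro ξ η
    have h1 := C.dualCm.peiffer ξ η
    rw [C.dualCm.lieTop.skew, ← C.dualCm.peiffer, hφ, hφ, map_neg, map_neg, LinearMap.neg_apply,
      LinearMap.neg_apply, neg_neg] at h1
    rw [← h1, neg_neg]

theorem IsCompatible.exists_crossedModule [CharZero K] {β : g →ₗ[K] g →ₗ[K] g}
    {ρ : g →ₗ[K] θ →ₗ[K] θ} {γ : Module.Dual K θ →ₗ[K] Module.Dual K θ →ₗ[K] Module.Dual K θ}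
    {σ : Module.Dual K θ →ₗ[K] Module.Dual K g →ₗ[K] Module.Dual K g} {φ : θ →ₗ[K] g}
    (h : IsCompatible β ρ γ σ φ) :
    ∃ C : LieBialgebraCrossedModule K θ g, C.cm.lieBase.bracket = β ∧ C.cm.act = ρ ∧
      C.dualCm.lieBase.bracket = γ ∧ C.dualCm.act = σ ∧ C.cm.φ = φ := by
  let A : LieStr K g := ⟨β, h.base_self, jacobi_of_self h.base_self h.base_jacobi⟩
  let A' : LieStr K (Module.Dual K θ) := ⟨γ, h.dual_self, jacobi_of_self h.dual_self h.dual_jacobi⟩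
  have hφ : ∀ ξ, (-φ.dualMap) ξ = -(ξ ∘ₗ φ) := fun _ => rfl
  let M : LieCrossedModule K θ g := LieCrossedModule.ofPeiffer A φ ρ h.act h.equivariant h.peiffer
  let M' : LieCrossedModule K (Module.Dual K g) (Module.Dual K θ) :=
    LieCrossedModule.ofPeiffer A' (-φ.dualMap) σ h.dual_act
      (by
        intro κ ξ
        rw [hφ, hφ, map_neg, h.dual_equivariant])
      (by
        intro ξ η
        rw [hφ, hφ, map_neg, map_neg, LinearMap.neg_apply, LinearMap.neg_apply, h.dual_peiffer])
  exact ⟨⟨M, M', rfl, (isLieBialgebra_semidirect_iff M M' rfl).2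
    ⟨h.matched_base, h.matched_dual⟩⟩, rfl, rfl, rfl, rfl, rfl⟩

end CrossedModules

end

noncomputable section

/-! ### Strict Lie 2-bialgebras and Lie bialgebra crossed modules -/

section Correspondence

variable {K θ g : Type*} [Field K] [CharZero K] [AddCommGroup θ] [Module K θ]
  [AddCommGroup g] [Module K g] [FiniteDimensional K θ] [FiniteDimensional K g]

open BigAlg

/-- The equation `{ε, ε} = 0` for the strict element with the given structure maps says that they
are those of a Lie bialgebra crossed module. -/
theorem bigBracket_self_eq_zero_iff_isCompatible {β : g →ₗ[K] g →ₗ[K] g} {ρ : g →ₗ[K] θ →ₗ[K] θ}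
    {γ : Module.Dual K θ →ₗ[K] Module.Dual K θ →ₗ[K] Module.Dual K θ}
    {σ : Module.Dual K θ →ₗ[K] Module.Dual K g →ₗ[K] Module.Dual K g} {φ : θ →ₗ[K] g}
    (hβ : ∀ x, β x x = 0) (hγ : ∀ κ, γ κ κ = 0) :
    bigBracket K θ g
      (baseElt β + actElt ρ + 0 + mapElt φ + dualBaseElt γ + dualActElt σ + 0)
      (baseElt β + actElt ρ + 0 + mapElt φ + dualBaseElt γ + dualActElt σ + 0) = 0 ↔
      IsCompatible β ρ γ σ φ := by
  obtain ⟨B₁, h₁, p₁⟩ := exists_derives_baseElt (θ := θ) β hβ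
  obtain ⟨B₂, h₂, p₂⟩ := exists_derives_actElt ρ
  obtain ⟨B₃, h₃, p₃⟩ := exists_derives_dualBaseElt (g := g) γ hγ
  obtain ⟨B₄, h₄, p₄⟩ := exists_derives_dualActElt σ
  have hd := ((h₁.add h₂).add h₃).add h₄
  let R : (θ × Module.Dual K g) →ₗ[K] (g × Module.Dual K θ) :=
    (φ ∘ₗ LinearMap.fst K θ (Module.Dual K g)).prod
      (φ.dualMap ∘ₗ LinearMap.snd K θ (Module.Dual K g))
  have he : Encodes (baseElt β + actElt ρ + dualBaseElt γ + dualActElt σ) (mapElt φ)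
      (B₁ + B₂ + B₃ + B₄) R :=
    { homog_left := hd.homog
      homog_right := isHomog_mapElt φ
      parity_left := hd.parity_eq
      parity_right := by simp [mapElt]
      oddDeriv_left := hd.oddDeriv_oddDeriv
      oddDeriv_right := fun w => by simp [mapElt]
      flipDeriv_right := flipDeriv_mapElt φ }
  have hsum : (baseElt β + actElt ρ + 0 + mapElt φ + dualBaseElt γ + dualActElt σ + 0 :
      BigAlg K θ g) = (baseElt β + actElt ρ + dualBaseElt γ + dualActElt σ) + mapElt φ := by
    abel
  rw [hsum, he.bigBracket_self_eq_zero_iff]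
  refine isCompatible_iff hβ hγ (fun w w' η => ?_) fun η => rfl
  simp only [LinearMap.add_apply, map_add, p₁, p₂, p₃, p₄]

/-- The strict Lie 2-bialgebra of a Lie bialgebra crossed module. -/
def LieBialgebraCrossedModule.toStrict (C : LieBialgebraCrossedModule K θ g) :
    StrictLie2Bialgebra K θ g :=
  ⟨{  ε12_00 := baseElt C.cm.lieBase.bracket
      ε01_11 := actElt C.cm.act
      ε03_10 := 0
      ε10_01 := mapElt C.cm.φ
      ε00_21 := dualBaseElt C.dualCm.lieBase.bracket
      ε11_10 := dualActElt C.dualCm.act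
      ε01_30 := 0
      mem12_00 := baseElt_mem _
      mem01_11 := actElt_mem _
      mem03_10 := Submodule.zero_mem _
      mem10_01 := mapElt_mem _
      mem00_21 := dualBaseElt_mem _
      mem11_10 := dualActElt_mem _
      mem01_30 := Submodule.zero_mem _
      bracket_self := (bigBracket_self_eq_zero_iff_isCompatible C.cm.lieBase.self
        C.dualCm.lieBase.self).2 C.isCompatible }, rfl, rfl⟩

omit [CharZero K] in
theorem bigBracket_mapElt (φ : θ →ₗ[K] g) (u : θ) :
    bigBracket K θ g (mapElt φ) (ofTop K θ g u) = ofBase K θ g (φ u) := by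
  refine (bigBracket_odd _ (u, 0)).trans ((flipDeriv_mapElt φ (u, 0)).trans ?_)
  rw [LinearMap.zero_comp]
  rfl

theorem bigBracket_bigBracket_baseElt {β : g →ₗ[K] g →ₗ[K] g} (hβ : ∀ x, β x x = 0) (x y : g) :
    bigBracket K θ g (bigBracket K θ g (baseElt β) (ofBase K θ g x)) (ofBase K θ g y) =
      ofBase K θ g (β x y) := by
  obtain ⟨B, h, p⟩ := exists_derives_baseElt (θ := θ) β hβ
  refine (h.bigBracket_even_even (x, 0) (y, 0)).trans (congrArg (even K) ?_)
  rw [← sub_eq_zero]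
  refine even_eq_zero_of_pairing fun η => ?_
  rw [map_sub, LinearMap.sub_apply, p]
  simp

omit [CharZero K] in
theorem bigBracket_bigBracket_actElt (ρ : g →ₗ[K] θ →ₗ[K] θ) (x : g) (u : θ) :
    bigBracket K θ g (bigBracket K θ g (actElt ρ) (ofBase K θ g x)) (ofTop K θ g u) =
      ofTop K θ g (ρ x u) := by
  obtain ⟨B, h, p⟩ := exists_derives_actElt ρ
  refine h.bigBracket_even_odd (x, 0) (u, 0) (ρ x u, 0) fun w' => ?_
  rw [p]
  simp

theorem bigBracket_bigBracket_dualBaseElt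
    {γ : Module.Dual K θ →ₗ[K] Module.Dual K θ →ₗ[K] Module.Dual K θ} (hγ : ∀ κ, γ κ κ = 0)
    (κ l : Module.Dual K θ) :
    bigBracket K θ g (bigBracket K θ g (dualBaseElt γ) (ofTopDual K θ g κ)) (ofTopDual K θ g l) =
      ofTopDual K θ g (γ κ l) := by
  obtain ⟨B, h, p⟩ := exists_derives_dualBaseElt (g := g) γ hγ
  refine (h.bigBracket_even_even (0, κ) (0, l)).trans (congrArg (even K) ?_)
  rw [← sub_eq_zero]
  refine even_eq_zero_of_pairing fun η => ?_
  rw [map_sub, LinearMap.sub_apply, p]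
  simp

omit [CharZero K] in
theorem bigBracket_bigBracket_dualActElt
    (σ : Module.Dual K θ →ₗ[K] Module.Dual K g →ₗ[K] Module.Dual K g) (κ : Module.Dual K θ)
    (ξ : Module.Dual K g) :
    bigBracket K θ g (bigBracket K θ g (dualActElt σ) (ofTopDual K θ g κ)) (ofBaseDual K θ g ξ) =
      ofBaseDual K θ g (σ κ ξ) := by
  obtain ⟨B, h, p⟩ := exists_derives_dualActElt σ
  refine h.bigBracket_even_odd (0, κ) (0, ξ) (0, σ κ ξ) fun w' => ?_
  rw [p]
  simp

omit [CharZero K] [FiniteDimensional K θ] [FiniteDimensional K g] in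
theorem ofBase_injective : Function.Injective (ofBase K θ g) :=
  even_injective.comp LinearMap.inl_injective

omit [CharZero K] [FiniteDimensional K θ] [FiniteDimensional K g] in
theorem ofTop_injective : Function.Injective (ofTop K θ g) :=
  odd_injective.comp LinearMap.inl_injective

omit [CharZero K] [FiniteDimensional K θ] [FiniteDimensional K g] in
theorem ofTopDual_injective : Function.Injective (ofTopDual K θ g) :=
  even_injective.comp LinearMap.inr_injective

omit [CharZero K] [FiniteDimensional K θ] [FiniteDimensional K g] in
theorem ofBaseDual_injective : Function.Injective (ofBaseDual K θ g) :=
  odd_injective.comp LinearMap.inr_injective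

omit [CharZero K] [FiniteDimensional K θ] [FiniteDimensional K g] in
/-- A Lie algebra crossed module is determined by its base, its map and its action: the Peiffer
identity recovers the other bracket. -/
theorem LieCrossedModule.ext_of_base {M N : LieCrossedModule K θ g}
    (hb : M.lieBase.bracket = N.lieBase.bracket) (hφ : M.φ = N.φ) (ha : M.act = N.act) :
    M = N := by
  refine LieCrossedModule.ext (LieStr.ext ?_) (LieStr.ext hb) hφ ha
  refine LinearMap.ext fun u => LinearMap.ext fun v => ?_
  rw [← M.peiffer, ← N.peiffer, hφ, ha]

theorem LieBialgebraCrossedModule.toStrict_injective :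
    Function.Injective (LieBialgebraCrossedModule.toStrict (K := K) (θ := θ) (g := g)) := by
  intro C D h
  have hβ : baseElt C.cm.lieBase.bracket = baseElt D.cm.lieBase.bracket :=
    congrArg (fun E => E.1.ε12_00) h
  have hρ : actElt C.cm.act = actElt D.cm.act := congrArg (fun E => E.1.ε01_11) h
  have hφ : mapElt C.cm.φ = mapElt D.cm.φ := congrArg (fun E => E.1.ε10_01) h
  have hγ : dualBaseElt C.dualCm.lieBase.bracket = dualBaseElt D.dualCm.lieBase.bracket :=
    congrArg (fun E => E.1.ε00_21) h
  have hσ : dualActElt C.dualCm.act = dualActElt D.dualCm.act :=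
    congrArg (fun E => E.1.ε11_10) h
  have h1 : C.cm.φ = D.cm.φ := LinearMap.ext fun u => ofBase_injective (K := K) (θ := θ) <| by
    rw [← bigBracket_mapElt, hφ, bigBracket_mapElt]
  refine LieBialgebraCrossedModule.ext (LieCrossedModule.ext_of_base ?_ h1 ?_)
    (LieCrossedModule.ext_of_base ?_ ?_ ?_)
  · refine LinearMap.ext fun x => LinearMap.ext fun y => ofBase_injective (K := K) (θ := θ) ?_
    rw [← bigBracket_bigBracket_baseElt C.cm.lieBase.self, hβ,
      bigBracket_bigBracket_baseElt D.cm.lieBase.self]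
  · refine LinearMap.ext fun x => LinearMap.ext fun u => ofTop_injective (K := K) (g := g) ?_
    rw [← bigBracket_bigBracket_actElt, hρ, bigBracket_bigBracket_actElt]
  · refine LinearMap.ext fun x => LinearMap.ext fun y => ofTopDual_injective (K := K) (g := g) ?_
    rw [← bigBracket_bigBracket_dualBaseElt C.dualCm.lieBase.self, hγ,
      bigBracket_bigBracket_dualBaseElt D.dualCm.lieBase.self]
  · rw [C.dual_φ, D.dual_φ, h1]
  · refine LinearMap.ext fun x => LinearMap.ext fun u => ofBaseDual_injective (K := K) (θ := θ) ?_
    rw [← bigBracket_bigBracket_dualActElt, hσ, bigBracket_bigBracket_dualActElt]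

theorem LieBialgebraCrossedModule.toStrict_surjective :
    Function.Surjective (LieBialgebraCrossedModule.toStrict (K := K) (θ := θ) (g := g)) := by
  rintro ⟨⟨e1, e2, e3, e4, e5, e6, e7, m1, m2, m3, m4, m5, m6, m7, hb⟩, h3, h7⟩
  dsimp only at h3 h7
  obtain ⟨β, hβ, rfl⟩ := exists_eq_baseElt m1
  obtain ⟨ρ, rfl⟩ := exists_eq_actElt m2
  obtain ⟨φ, rfl⟩ := exists_eq_mapElt m4
  obtain ⟨γ, hγ, rfl⟩ := exists_eq_dualBaseElt m5
  obtain ⟨σ, rfl⟩ := exists_eq_dualActElt m6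
  subst h3 h7
  obtain ⟨C, rfl, rfl, rfl, rfl, rfl⟩ :=
    ((bigBracket_self_eq_zero_iff_isCompatible hβ hγ).1 hb).exists_crossedModule
  exact ⟨C, rfl⟩

end Correspondence

end

theorem mainTheorem1 {K θ g : Type*} [Field K] [CharZero K]
    [AddCommGroup θ] [Module K θ] [FiniteDimensional K θ]
    [AddCommGroup g] [Module K g] [FiniteDimensional K g] :
    ∃ Ψ : StrictLie2Bialgebra K θ g ≃ LieBialgebraCrossedModule K θ g,
      ∀ E : StrictLie2Bialgebra K θ g,
        (∀ u : θ, BigAlg.ofBase K θ g ((Ψ E).cm.φ u) =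
          BigAlg.bigBracket K θ g E.1.ε10_01 (BigAlg.ofTop K θ g u)) ∧
        (∀ x y : g, BigAlg.ofBase K θ g ((Ψ E).cm.lieBase.bracket x y) =
          BigAlg.bigBracket K θ g
            (BigAlg.bigBracket K θ g E.1.ε12_00 (BigAlg.ofBase K θ g x))
            (BigAlg.ofBase K θ g y)) ∧
        (∀ (x : g) (u : θ), BigAlg.ofTop K θ g ((Ψ E).cm.act x u) =
          BigAlg.bigBracket K θ g
            (BigAlg.bigBracket K θ g E.1.ε01_11 (BigAlg.ofBase K θ g x))
            (BigAlg.ofTop K θ g u)) ∧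
        (∀ κ₁ κ₂ : Module.Dual K θ,
          BigAlg.ofTopDual K θ g ((Ψ E).dualCm.lieBase.bracket κ₁ κ₂) =
          BigAlg.bigBracket K θ g
            (BigAlg.bigBracket K θ g E.1.ε00_21 (BigAlg.ofTopDual K θ g κ₁))
            (BigAlg.ofTopDual K θ g κ₂)) ∧
        (∀ (κ : Module.Dual K θ) (ξ : Module.Dual K g),
          BigAlg.ofBaseDual K θ g ((Ψ E).dualCm.act κ ξ) =
          BigAlg.bigBracket K θ g
            (BigAlg.bigBracket K θ g E.1.ε11_10 (BigAlg.ofTopDual K θ g κ))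
            (BigAlg.ofBaseDual K θ g ξ)) := by
  let e := Equiv.ofBijective (LieBialgebraCrossedModule.toStrict (K := K) (θ := θ) (g := g))
    ⟨LieBialgebraCrossedModule.toStrict_injective, LieBialgebraCrossedModule.toStrict_surjective⟩
  refine ⟨e.symm, fun E => ?_⟩
  obtain ⟨C, rfl⟩ := e.surjective E
  rw [e.symm_apply_apply]
  exact ⟨fun u => (bigBracket_mapElt _ u).symm,
    fun x y => (bigBracket_bigBracket_baseElt C.cm.lieBase.self x y).symm,
    fun x u => (bigBracket_bigBracket_actElt _ x u).symm,
    fun κ l => (bigBracket_bigBracket_dualBaseElt C.dualCm.lieBase.self κ l).symm,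
    fun κ ξ => (bigBracket_bigBracket_dualActElt _ κ ξ).symm⟩
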